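/- Let $k$ be a commutative ring and $G$ a group. Algebras are associative $k$-algebras, not necessarily with unit, and $\otimes=\otimes_k$. A left module $M$ over an algebra $R$ is unital if the canonical map $R\otimes_R M\to M$ is an isomorphism, and an algebra $A$ is unital if $A\otimes_A A\to A$ is an isomorphism; put $A^{\rm e}=A\otimes A^{\rm op}$. A Taylor–Azumaya algebra is a unital algebra $A$, faithful as a $k$-module, for which the adjoint functors $N\mapsto A\otimes N$, from $k$-modules to unital left $A^{\rm e}$-modules, and $M\mapsto {\rm Hom}_{A^{\rm e}}(A,M)$ are inverse equivalences. It is a $G$-module Taylor–Azumaya algebra if $G$ acts on it by $k$-algebra automorphisms. For a $G$-module Taylor–Azumaya algebra $A$, let $A\# kG=\bigoplus_{g\in G}A\# g$ be the smash product, with $(a\# g)(b\# h)=a(g\cdot b)\# gh$ and with the $A^{\rm e}$-module structure $(a\otimes a')\cdot (b\# g)=ab(g\cdot a')\# g$. The $k$-module ${\rm Hom}_{A^{\rm e}}(A,A\# kG)$ is an algebra with unit $a\mapsto a\# 1$ and with the product determined by $(\varphi\psi)(ab)=\varphi(a)\psi(b)$; its part of degree $g$ consists of the $\varphi$ with $\varphi(A)\subseteq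 A\# g$. For $G$-graded algebras $S$ and $T$ with unit, the cotensor product is the $G$-graded algebra $S\square T=\bigoplus_{g\in G}S_g\otimes T_g$, with $(s\otimes t)(s'\otimes t')=ss'\otimes tt'$. Let $A$ and $B$ be $G$-module Taylor–Azumaya algebras, and let $G$ act diagonally on $A\otimes B$. Then ${\rm Hom}_{A^{\rm e}}(A,A\# kG)$, ${\rm Hom}_{B^{\rm e}}(B,B\# kG)$ and ${\rm Hom}_{(A\otimes B)^{\rm e}}(A\otimes B,(A\otimes B)\# kG)$ are $G$-graded algebras (each is the direct sum of its homogeneous parts), and there is an isomorphism of $G$-graded $k$-algebras $${\rm Hom}_{A^{\rm e}}(A,A\# kG)\,\square\,{\rm Hom}_{B^{\rm e}}(B,B\# kG)\;\cong\;{\rm Hom}_{(A\otimes B)^{\rm e}}\bigl(A\otimes B,(A\otimes B)\# kG\bigr).$$ -/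

import Mathlib

open scoped TensorProduct DirectSum

universe u

noncomputable section

namespace TaylorAzumaya

/-! ### Modules over algebras without unit

A left module over a (not necessarily unital) `k`-algebra `R` is a `k`-module `M` together with a
homomorphism `ρ : R →ₙₐ[k] Module.End k M` of algebras without unit. -/

section Modules

variable {k R M M' : Type u} [CommRing k] [NonUnitalRing R] [Module k R]
  [AddCommGroup M] [Module k M] [AddCommGroup M'] [Module k M']

/-- The submodule of `R ⊗[k] M` generated by the elements `rs ⊗ m - r ⊗ sm`. -/
def balancing (ρ : R →ₙₐ[k] Module.End k M) : Submodule k (R ⊗[k] M) :=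
  Submodule.span k {t | ∃ (r s : R) (m : M), t = (r * s) ⊗ₜ[k] m - r ⊗ₜ[k] (ρ s m)}

/-- The tensor product `R ⊗_R M`. -/
abbrev RelTensor (ρ : R →ₙₐ[k] Module.End k M) : Type u := (R ⊗[k] M) ⧸ balancing ρ

/-- The map `R ⊗[k] M → M`, `r ⊗ m ↦ rm`. -/
def actMap (ρ : R →ₙₐ[k] Module.End k M) : R ⊗[k] M →ₗ[k] M :=
  TensorProduct.lift (ρ : R →ₗ[k] Module.End k M)

@[simp] theorem actMap_tmul (ρ : R →ₙₐ[k] Module.End k M) (r : R) (m : M) :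
    actMap ρ (r ⊗ₜ m) = ρ r m := rfl

theorem balancing_le_ker (ρ : R →ₙₐ[k] Module.End k M) :
    balancing ρ ≤ LinearMap.ker (actMap ρ) := by
  refine Submodule.span_le.2 ?_
  rintro _ ⟨r, s, m, rfl⟩
  simp [map_mul]

/-- The canonical map `R ⊗_R M → M`, `r ⊗ m ↦ rm`. -/
def relAct (ρ : R →ₙₐ[k] Module.End k M) : RelTensor ρ →ₗ[k] M :=
  (balancing ρ).liftQ (actMap ρ) (balancing_le_ker ρ)

/-- A left `R`-module `M` is unital if the canonical map `R ⊗_R M → M` is an isomorphism. -/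
def IsUnitalModule (ρ : R →ₙₐ[k] Module.End k M) : Prop :=
  Function.Bijective (relAct ρ)

/-- The `k`-module `Hom_R(M, M')` of `R`-linear maps. -/
def moduleHom (ρ : R →ₙₐ[k] Module.End k M) (ρ' : R →ₙₐ[k] Module.End k M') :
    Submodule k (M →ₗ[k] M') where
  carrier := {f | ∀ (r : R) (m : M), f (ρ r m) = ρ' r (f m)}
  add_mem' hf hg r m := by simp [hf r m, hg r m]
  zero_mem' r m := by simp
  smul_mem' c f hf r m := by simp [hf r m]

/-- The left `R`-module `M ⊗[k] N`, with action `r(m ⊗ n) = rm ⊗ n`. -/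
def tensorAct (ρ : R →ₙₐ[k] Module.End k M) (N : Type u) [AddCommGroup N] [Module k N] :
    R →ₙₐ[k] Module.End k (M ⊗[k] N) where
  toFun r := (ρ r).rTensor N
  map_smul' c r := by simp [LinearMap.rTensor_smul]
  map_zero' := by simp
  map_add' r s := by simp [LinearMap.rTensor_add]
  map_mul' r s := by rw [map_mul, Module.End.mul_eq_comp, LinearMap.rTensor_comp]; rfl

end Modules

/-! ### Taylor–Azumaya algebras -/

section Algebras

variable (k A : Type u) [CommRing k]
  [NonUnitalRing A] [Module k A] [IsScalarTower k A A] [SMulCommClass k A A]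

/-- An algebra `A`, with or without unit element, is called unital if the canonical map
`A ⊗_A A → A` is an isomorphism. -/
class IsUnitalAlgebra : Prop where
  unital : IsUnitalModule (NonUnitalAlgHom.lmul k A)

variable {k A}
variable {S : Type u} [NonUnitalRing S] [Module k S] [IsScalarTower k S S] [SMulCommClass k S S]

/-- A homomorphism of algebras `η : A → S` makes `S` an `A`-bimodule, that is, a left module
over the enveloping algebra `A ⊗ Aᵒᵖ`, with action `(a ⊗ a') s = η(a) s η(a')`. -/
def envAct (η : A →ₙₐ[k] S) : A ⊗[k] Aᵐᵒᵖ →ₙₐ[k] Module.End k S :=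
  let L : A ⊗[k] Aᵐᵒᵖ →ₗ[k] Module.End k S := TensorProduct.lift
    (LinearMap.mk₂ k
      (fun a (a' : Aᵐᵒᵖ) => LinearMap.mulLeft k (η a) ∘ₗ LinearMap.mulRight k (η a'.unop))
      (fun a b c => by ext; simp [add_mul])
      (fun c a b => by ext; simp [smul_mul_assoc])
      (fun a b c => by ext; simp [mul_add])
      (fun c a b => by ext; simp [mul_smul_comm]))
  { toFun := L
    map_smul' := fun c x => by simp
    map_zero' := map_zero L
    map_add' := map_add L
    map_mul' := fun x y => by
      induction x with
      | zero => simp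
      | add x x' hx hx' => rw [add_mul, map_add, hx, hx', map_add, add_mul]
      | tmul a a' =>
        induction y with
        | zero => simp
        | add y y' hy hy' => rw [mul_add, map_add, hy, hy', map_add, mul_add]
        | tmul b b' => ext s; simp [L, mul_assoc] }

@[simp] theorem envAct_tmul (η : A →ₙₐ[k] S) (a : A) (a' : Aᵐᵒᵖ) (s : S) :
    envAct η (a ⊗ₜ a') s = η a * (s * η a'.unop) := rfl

variable (k A)

/-- `A` as a left module over its enveloping algebra, with action `(a ⊗ a') b = a b a'`. -/
abbrev selfAct : A ⊗[k] Aᵐᵒᵖ →ₙₐ[k] Module.End k A := envAct (NonUnitalAlgHom.id k A)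

/-- The unit `N → Hom_{Aᵉ}(A, A ⊗ N)`, `n ↦ (a ↦ a ⊗ n)`, of the adjunction between the functors
`A ⊗ -` and `Hom_{Aᵉ}(A, -)`. -/
def unitMap (N : Type u) [AddCommGroup N] [Module k N] :
    N →ₗ[k] moduleHom (selfAct k A) (tensorAct (selfAct k A) N) :=
  LinearMap.codRestrict _ (TensorProduct.mk k A N).flip fun _ _ _ => rfl

/-- The counit `A ⊗ Hom_{Aᵉ}(A, M) → M`, `a ⊗ f ↦ f(a)`, of the adjunction between the functors
`A ⊗ -` and `Hom_{Aᵉ}(A, -)`. -/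
def counitMap {M : Type u} [AddCommGroup M] [Module k M]
    (ρ : A ⊗[k] Aᵐᵒᵖ →ₙₐ[k] Module.End k M) :
    A ⊗[k] moduleHom (selfAct k A) ρ →ₗ[k] M :=
  TensorProduct.lift (Submodule.subtype (moduleHom (selfAct k A) ρ)).flip

/-- A Taylor–Azumaya algebra is a unital algebra `A`, faithful as a `k`-module, for which the
adjoint functors `N ↦ A ⊗ N`, from `k`-modules to unital left `Aᵉ`-modules, and
`M ↦ Hom_{Aᵉ}(A, M)` are inverse equivalences: the unit and the counit are isomorphisms. -/
class IsTaylorAzumaya : Prop extends IsUnitalAlgebra k A where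
  faithful : ∀ c : k, (∀ a : A, c • a = 0) → c = 0
  unit_bijective : ∀ (N : Type u) [AddCommGroup N] [Module k N],
    Function.Bijective (unitMap k A N)
  counit_bijective : ∀ (M : Type u) [AddCommGroup M] [Module k M]
    (ρ : A ⊗[k] Aᵐᵒᵖ →ₙₐ[k] Module.End k M), IsUnitalModule ρ →
    Function.Bijective (counitMap k A ρ)

/-! ### The algebra `Hom_{Aᵉ}(A, S)` -/

variable {k A}

/-- For a homomorphism of algebras `η : A → S`, the `k`-module `Hom_{Aᵉ}(A, S)`. -/
abbrev EnvHom (η : A →ₙₐ[k] S) : Submodule k (A →ₗ[k] S) := moduleHom (selfAct k A) (envAct η)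

/-- A unital algebra is spanned by products. -/
theorem span_mul_eq_top [IsUnitalAlgebra k A] :
    Submodule.span k {x : A | ∃ a b : A, a * b = x} = ⊤ := by
  rw [eq_top_iff]
  rintro x -
  obtain ⟨t, rfl⟩ := (IsUnitalAlgebra.unital (k := k) (A := A)).2 x
  obtain ⟨t, rfl⟩ := Submodule.Quotient.mk_surjective _ t
  change actMap _ t ∈ _
  induction t with
  | zero => simp
  | add x y hx hy => rw [map_add]; exact add_mem hx hy
  | tmul a b => exact Submodule.subset_span ⟨a, b, rfl⟩

@[elab_as_elim]
theorem mul_induction [IsUnitalAlgebra k A] {p : A → Prop} (x : A) (zero : p 0)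
    (mul : ∀ a b, p (a * b)) (add : ∀ x y, p x → p y → p (x + y)) : p x := by
  have hx : x ∈ Submodule.span k {x : A | ∃ a b : A, a * b = x} := by
    rw [span_mul_eq_top]; trivial
  refine Submodule.closure_induction (p := fun x _ => p x) zero (fun x y _ _ => add x y) ?_ hx
  intro c y hy
  obtain ⟨a, b, rfl⟩ := hy
  rw [← smul_mul_assoc]
  exact mul _ _

theorem EnvHom.map_mul_left [IsUnitalAlgebra k A] {η : A →ₙₐ[k] S} (f : EnvHom η) (a b : A) :
    f.1 (a * b) = η a * f.1 b := by
  refine mul_induction (k := k) b (by simp) (fun b d => ?_)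
    (fun x y hx hy => by rw [mul_add, map_add, hx, hy, map_add, mul_add])
  refine mul_induction (k := k) b (by simp) (fun b c => ?_)
    (fun x y hx hy => by rw [add_mul, mul_add, map_add, hx, hy, map_add, mul_add])
  have h1 := f.2 ((a * b) ⊗ₜ MulOpposite.op d) c
  have h2 := f.2 (b ⊗ₜ MulOpposite.op d) c
  simp only [envAct_tmul, NonUnitalAlgHom.coe_id, id_eq, MulOpposite.unop_op, map_mul] at h1 h2
  rw [mul_assoc b c d, h2, ← mul_assoc a b, h1, mul_assoc]

theorem EnvHom.map_mul_right [IsUnitalAlgebra k A] {η : A →ₙₐ[k] S} (f : EnvHom η) (a b : A) :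
    f.1 (a * b) = f.1 a * η b := by
  refine mul_induction (k := k) a (by simp) (fun a d => ?_)
    (fun x y hx hy => by rw [add_mul, map_add, hx, hy, map_add, add_mul])
  refine mul_induction (k := k) d (by simp) (fun c d => ?_)
    (fun x y hx hy => by rw [mul_add, add_mul, map_add, hx, hy, map_add, add_mul])
  have h1 := f.2 (a ⊗ₜ MulOpposite.op (d * b)) c
  have h2 := f.2 (a ⊗ₜ MulOpposite.op d) c
  simp only [envAct_tmul, NonUnitalAlgHom.coe_id, id_eq, MulOpposite.unop_op, map_mul] at h1 h2
  rw [h2, mul_assoc a, mul_assoc c, h1]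
  simp only [mul_assoc]

theorem EnvHom.mem_of_map_mul {η : A →ₙₐ[k] S} (f : A →ₗ[k] S)
    (hl : ∀ a b, f (a * b) = η a * f b) (hr : ∀ a b, f (a * b) = f a * η b) : f ∈ EnvHom η := by
  intro r m
  induction r with
  | zero => simp
  | add x y hx hy => simp only [map_add, LinearMap.add_apply, hx, hy]
  | tmul a a' =>
    simp only [envAct_tmul, NonUnitalAlgHom.coe_id, id_eq]
    rw [hl, hr]

/-- The product on `Hom_{Aᵉ}(A, S)` as a linear map:
`A ≅ A ⊗_A A → S ⊗ S → S`, with `(φψ)(ab) = φ(a)ψ(b)`. -/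
def EnvHom.mulAux [IsUnitalAlgebra k A] {η : A →ₙₐ[k] S} (φ ψ : EnvHom η) : A →ₗ[k] S :=
  (balancing (NonUnitalAlgHom.lmul k A)).liftQ
      (LinearMap.mul' k S ∘ₗ TensorProduct.map φ.1 ψ.1) (by
        refine Submodule.span_le.2 ?_
        rintro _ ⟨a, b, c, rfl⟩
        simp [EnvHom.map_mul_left ψ, EnvHom.map_mul_right φ, mul_assoc])
    ∘ₗ (LinearEquiv.ofBijective _ (IsUnitalAlgebra.unital (k := k) (A := A))).symm.toLinearMap

theorem EnvHom.mulAux_apply [IsUnitalAlgebra k A] {η : A →ₙₐ[k] S} (φ ψ : EnvHom η) (a b : A) :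
    EnvHom.mulAux φ ψ (a * b) = φ.1 a * ψ.1 b := by
  have h : (LinearEquiv.ofBijective _ (IsUnitalAlgebra.unital (k := k) (A := A))).symm (a * b)
      = Submodule.Quotient.mk (a ⊗ₜ b) := by
    rw [LinearEquiv.symm_apply_eq]; rfl
  simp only [EnvHom.mulAux, LinearMap.comp_apply, LinearEquiv.coe_coe, h]
  rfl

theorem EnvHom.mulAux_mem [IsUnitalAlgebra k A] {η : A →ₙₐ[k] S} (φ ψ : EnvHom η) :
    EnvHom.mulAux φ ψ ∈ EnvHom η := by
  refine EnvHom.mem_of_map_mul _ (fun a b => ?_) (fun a b => ?_)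
  · refine mul_induction (k := k) b (by simp) (fun b c => ?_)
      (fun x y hx hy => by rw [mul_add, map_add, hx, hy, map_add, mul_add])
    rw [← mul_assoc, EnvHom.mulAux_apply, EnvHom.mulAux_apply, EnvHom.map_mul_left, mul_assoc]
  · refine mul_induction (k := k) a (by simp) (fun a c => ?_)
      (fun x y hx hy => by rw [add_mul, map_add, hx, hy, map_add, add_mul])
    rw [mul_assoc, EnvHom.mulAux_apply, EnvHom.mulAux_apply, EnvHom.map_mul_right, mul_assoc]

instance EnvHom.instMul [IsUnitalAlgebra k A] (η : A →ₙₐ[k] S) : Mul (EnvHom η) :=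
  ⟨fun φ ψ => ⟨EnvHom.mulAux φ ψ, EnvHom.mulAux_mem φ ψ⟩⟩

instance EnvHom.instOne (η : A →ₙₐ[k] S) : One (EnvHom η) :=
  ⟨⟨(η : A →ₗ[k] S), EnvHom.mem_of_map_mul _ (by simp) (by simp)⟩⟩

theorem EnvHom.mul_apply [IsUnitalAlgebra k A] {η : A →ₙₐ[k] S} (φ ψ : EnvHom η) (a b : A) :
    (φ * ψ).1 (a * b) = φ.1 a * ψ.1 b := EnvHom.mulAux_apply φ ψ a b

theorem EnvHom.one_apply {η : A →ₙₐ[k] S} (a : A) : (1 : EnvHom η).1 a = η a := rfl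

theorem EnvHom.ext_mul [IsUnitalAlgebra k A] {η : A →ₙₐ[k] S} {φ ψ : EnvHom η}
    (h : ∀ a b, φ.1 (a * b) = ψ.1 (a * b)) : φ = ψ := by
  refine Subtype.ext (LinearMap.ext fun x => ?_)
  exact mul_induction (k := k) x (by simp) h (fun x y hx hy => by rw [map_add, hx, hy, map_add])

instance EnvHom.instRing [IsUnitalAlgebra k A] (η : A →ₙₐ[k] S) : Ring (EnvHom η) where
  __ := (inferInstance : AddCommGroup (EnvHom η))
  __ := EnvHom.instMul η
  __ := EnvHom.instOne η
  left_distrib φ ψ χ := EnvHom.ext_mul fun a b => by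
    change _ = (φ * ψ).1 (a * b) + (φ * χ).1 (a * b)
    simp only [EnvHom.mul_apply]
    exact mul_add _ _ _
  right_distrib φ ψ χ := EnvHom.ext_mul fun a b => by
    change _ = (φ * χ).1 (a * b) + (ψ * χ).1 (a * b)
    simp only [EnvHom.mul_apply]
    exact add_mul _ _ _
  zero_mul φ := EnvHom.ext_mul fun a b => by
    rw [EnvHom.mul_apply]; exact zero_mul _
  mul_zero φ := EnvHom.ext_mul fun a b => by
    rw [EnvHom.mul_apply]; exact mul_zero _
  mul_assoc φ ψ χ := EnvHom.ext_mul fun a b => by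
    refine mul_induction (k := k) a (by simp) (fun a c => ?_)
      (fun x y hx hy => by rw [add_mul, map_add, hx, hy, map_add])
    rw [EnvHom.mul_apply, EnvHom.mul_apply, mul_assoc a c b, EnvHom.mul_apply, EnvHom.mul_apply,
      mul_assoc]
  one_mul φ := EnvHom.ext_mul fun a b => by
    rw [EnvHom.mul_apply, EnvHom.one_apply, EnvHom.map_mul_left]
  mul_one φ := EnvHom.ext_mul fun a b => by
    rw [EnvHom.mul_apply, EnvHom.one_apply, EnvHom.map_mul_right]
  neg_add_cancel φ := neg_add_cancel φ
  zsmul := (· • ·)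
  zsmul_zero' := zero_zsmul
  zsmul_succ' := fun n a => by simp [add_zsmul]
  zsmul_neg' := fun n a => by simp [add_zsmul, Int.negSucc_eq]

instance EnvHom.instAlgebra [IsUnitalAlgebra k A] (η : A →ₙₐ[k] S) : Algebra k (EnvHom η) :=
  Algebra.ofModule
    (fun c φ ψ => EnvHom.ext_mul fun a b => by
      change _ = c • (φ * ψ).1 (a * b)
      simp only [EnvHom.mul_apply]
      exact smul_mul_assoc _ _ _)
    (fun c φ ψ => EnvHom.ext_mul fun a b => by
      change _ = c • (φ * ψ).1 (a * b)
      simp only [EnvHom.mul_apply]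
      exact mul_smul_comm _ _ _)

end Algebras

/-! ### The tensor product of unital algebras is unital -/

section Tensor

variable {k A B : Type u} [CommRing k]
  [NonUnitalRing A] [Module k A] [IsScalarTower k A A] [SMulCommClass k A A]
  [NonUnitalRing B] [Module k B] [IsScalarTower k B B] [SMulCommClass k B B]

theorem relTensor_move (a b c : A) :
    (Submodule.Quotient.mk ((a * b) ⊗ₜ[k] c) : RelTensor (NonUnitalAlgHom.lmul k A))
      = Submodule.Quotient.mk (a ⊗ₜ[k] (b * c)) :=
  (Submodule.Quotient.eq _).2 (Submodule.subset_span ⟨a, b, c, rfl⟩)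

/-- Two `k`-linear maps out of a unital algebra that agree on products are equal. -/
theorem ext_on_mul [IsUnitalAlgebra k A] {M : Type u} [AddCommGroup M] [Module k M]
    {f g : A →ₗ[k] M} (h : ∀ a b, f (a * b) = g (a * b)) : f = g :=
  LinearMap.ext fun x => mul_induction (k := k) x (by rw [map_zero, map_zero]) h
    (fun x y hx hy => by rw [map_add, hx, hy, map_add])

/-- In `(A ⊗ B) ⊗_{A ⊗ B} (A ⊗ B)` factors from `A` may be moved across the tensor sign. -/
theorem relTensor_move_left [IsUnitalAlgebra k A] [IsUnitalAlgebra k B] (a c d : A) (x y : B) :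
    (Submodule.Quotient.mk (((a * c) ⊗ₜ[k] x) ⊗ₜ[k] (d ⊗ₜ[k] y)) :
      RelTensor (NonUnitalAlgHom.lmul k (A ⊗[k] B)))
      = Submodule.Quotient.mk ((a ⊗ₜ[k] x) ⊗ₜ[k] ((c * d) ⊗ₜ[k] y)) := by
  let q := (balancing (NonUnitalAlgHom.lmul k (A ⊗[k] B))).mkQ
  change q _ = q _
  have indA : ∀ {p : A → Prop} (x : A) (zero : p 0) (mul : ∀ a b, p (a * b))
      (add : ∀ x y, p x → p y → p (x + y)), p x :=
    fun x zero mul add => mul_induction (k := k) x zero mul add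
  have indB : ∀ {p : B → Prop} (x : B) (zero : p 0) (mul : ∀ a b, p (a * b))
      (add : ∀ x y, p x → p y → p (x + y)), p x :=
    fun x zero mul add => mul_induction (k := k) x zero mul add
  have mv : ∀ u v w : A ⊗[k] B, q ((u * v) ⊗ₜ w) = q (u ⊗ₜ (v * w)) := relTensor_move
  induction d using indA with
  | zero => simp
  | add d d' h h' => simp only [mul_add, TensorProduct.add_tmul, TensorProduct.tmul_add, map_add, h, h']
  | mul d e =>
    induction y using indB with
    | zero => simp
    | add y y' h h' => simp only [TensorProduct.tmul_add, map_add, h, h']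
    | mul y z =>
      induction z using indB with
      | zero => simp
      | add z z' h h' => simp only [mul_add, TensorProduct.tmul_add, map_add, h, h']
      | mul z w =>
        have h1 := mv ((a * c) ⊗ₜ x) (d ⊗ₜ (y * z)) (e ⊗ₜ w)
        have h2 := mv (a ⊗ₜ x) ((c * d) ⊗ₜ (y * z)) (e ⊗ₜ w)
        simp only [Algebra.TensorProduct.tmul_mul_tmul] at h1 h2
        rw [← mul_assoc y z w, ← h1, ← mul_assoc c d e, ← h2, mul_assoc a c d]

/-- In `(A ⊗ B) ⊗_{A ⊗ B} (A ⊗ B)` factors from `B` may be moved across the tensor sign. -/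
theorem relTensor_move_right [IsUnitalAlgebra k A] [IsUnitalAlgebra k B] (a d : A) (x z y : B) :
    (Submodule.Quotient.mk ((a ⊗ₜ[k] (x * z)) ⊗ₜ[k] (d ⊗ₜ[k] y)) :
      RelTensor (NonUnitalAlgHom.lmul k (A ⊗[k] B)))
      = Submodule.Quotient.mk ((a ⊗ₜ[k] x) ⊗ₜ[k] (d ⊗ₜ[k] (z * y))) := by
  let q := (balancing (NonUnitalAlgHom.lmul k (A ⊗[k] B))).mkQ
  change q _ = q _
  have indA : ∀ {p : A → Prop} (x : A) (zero : p 0) (mul : ∀ a b, p (a * b))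
      (add : ∀ x y, p x → p y → p (x + y)), p x :=
    fun x zero mul add => mul_induction (k := k) x zero mul add
  have indB : ∀ {p : B → Prop} (x : B) (zero : p 0) (mul : ∀ a b, p (a * b))
      (add : ∀ x y, p x → p y → p (x + y)), p x :=
    fun x zero mul add => mul_induction (k := k) x zero mul add
  have mv : ∀ u v w : A ⊗[k] B, q ((u * v) ⊗ₜ w) = q (u ⊗ₜ (v * w)) := relTensor_move
  induction y using indB with
  | zero => simp
  | add d d' h h' => simp only [mul_add, TensorProduct.tmul_add, map_add, h, h']
  | mul y w =>
    induction d using indA with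
    | zero => simp
    | add y y' h h' => simp only [TensorProduct.tmul_add, TensorProduct.add_tmul, map_add, h, h']
    | mul d e =>
      induction e using indA with
      | zero => simp
      | add z z' h h' =>
        simp only [mul_add, TensorProduct.tmul_add, TensorProduct.add_tmul, map_add, h, h']
      | mul e f =>
        have h1 := mv (a ⊗ₜ (x * z)) ((d * e) ⊗ₜ y) (f ⊗ₜ w)
        have h2 := mv (a ⊗ₜ x) ((d * e) ⊗ₜ (z * y)) (f ⊗ₜ w)
        simp only [Algebra.TensorProduct.tmul_mul_tmul] at h1 h2
        rw [← mul_assoc d e f, ← h1, ← mul_assoc z y w, ← h2, mul_assoc x z y]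

/-- The map `A ⊗_A A → (B ⊗_B B → (A ⊗ B) ⊗_{A ⊗ B} (A ⊗ B))`. -/
theorem exists_relTensor_map [IsUnitalAlgebra k A] [IsUnitalAlgebra k B] :
    ∃ g : A ⊗[k] B →ₗ[k] RelTensor (NonUnitalAlgHom.lmul k (A ⊗[k] B)), ∀ (a c : A) (x y : B),
      g ((a * c) ⊗ₜ (x * y)) = Submodule.Quotient.mk ((a ⊗ₜ x) ⊗ₜ (c ⊗ₜ y)) := by
  let q := (balancing (NonUnitalAlgHom.lmul k (A ⊗[k] B))).mkQ
  let eA := LinearEquiv.ofBijective _ (IsUnitalAlgebra.unital (k := k) (A := A))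
  let eB := LinearEquiv.ofBijective _ (IsUnitalAlgebra.unital (k := k) (A := B))
  -- the map `(a ⊗ c) ↦ (x ⊗ y) ↦ (a ⊗ x) ⊗ (c ⊗ y)`
  let φ : A ⊗[k] A →ₗ[k] B ⊗[k] B →ₗ[k] RelTensor (NonUnitalAlgHom.lmul k (A ⊗[k] B)) :=
    (TensorProduct.mk k (A ⊗[k] A) (B ⊗[k] B)).compr₂
      (q ∘ₗ (TensorProduct.tensorTensorTensorComm k A A B B).toLinearMap)
  have hφ : ∀ a c x y, φ (a ⊗ₜ c) (x ⊗ₜ y) = q ((a ⊗ₜ x) ⊗ₜ (c ⊗ₜ y)) := fun _ _ _ _ => rfl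
  have hA : balancing (NonUnitalAlgHom.lmul k A) ≤ LinearMap.ker φ := by
    refine Submodule.span_le.2 ?_
    rintro _ ⟨a, c, d, rfl⟩
    rw [SetLike.mem_coe, LinearMap.mem_ker, map_sub, sub_eq_zero]
    refine TensorProduct.ext' fun x y => ?_
    rw [hφ]
    exact relTensor_move_left a c d x y
  let ψ := ((balancing (NonUnitalAlgHom.lmul k A)).liftQ φ hA).flip
  let ψ' : B ⊗[k] B →ₗ[k] _ := φ.flip
  have hB : balancing (NonUnitalAlgHom.lmul k B) ≤ LinearMap.ker ψ' := by
    refine Submodule.span_le.2 ?_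
    rintro _ ⟨x, z, y, rfl⟩
    rw [SetLike.mem_coe, LinearMap.mem_ker, map_sub, sub_eq_zero]
    refine TensorProduct.ext' fun a d => ?_
    exact relTensor_move_right a d x z y
  have hB' : balancing (NonUnitalAlgHom.lmul k B) ≤ LinearMap.ker ψ := by
    intro t ht
    have := hB ht
    rw [LinearMap.mem_ker] at this ⊢
    refine LinearMap.ext fun s => ?_
    obtain ⟨s, rfl⟩ := Submodule.Quotient.mk_surjective _ s
    exact LinearMap.congr_fun this s
  let χ := (balancing (NonUnitalAlgHom.lmul k B)).liftQ ψ hB'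
  refine ⟨TensorProduct.lift ((χ.flip ∘ₗ eA.symm.toLinearMap).compl₂ eB.symm.toLinearMap),
    fun a c x y => ?_⟩
  have h1 : eA.symm (a * c) = Submodule.Quotient.mk (a ⊗ₜ c) := by
    rw [LinearEquiv.symm_apply_eq]; rfl
  have h2 : eB.symm (x * y) = Submodule.Quotient.mk (x ⊗ₜ y) := by
    rw [LinearEquiv.symm_apply_eq]; rfl
  simp only [TensorProduct.lift.tmul, LinearMap.compl₂_apply, LinearMap.comp_apply,
    LinearEquiv.coe_coe, h1, h2]
  rfl

instance IsUnitalAlgebra.tensor [IsUnitalAlgebra k A] [IsUnitalAlgebra k B] :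
    IsUnitalAlgebra k (A ⊗[k] B) where
  unital := by
    have indA : ∀ {p : A → Prop} (x : A) (zero : p 0) (mul : ∀ a b, p (a * b))
        (add : ∀ x y, p x → p y → p (x + y)), p x :=
      fun x zero mul add => mul_induction (k := k) x zero mul add
    have indB : ∀ {p : B → Prop} (x : B) (zero : p 0) (mul : ∀ a b, p (a * b))
        (add : ∀ x y, p x → p y → p (x + y)), p x :=
      fun x zero mul add => mul_induction (k := k) x zero mul add
    obtain ⟨g, hg⟩ := exists_relTensor_map (k := k) (A := A) (B := B)
    constructor
    · refine Function.LeftInverse.injective (g := g) fun t => ?_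
      obtain ⟨t, rfl⟩ := Submodule.Quotient.mk_surjective _ t
      suffices h : g ∘ₗ actMap (NonUnitalAlgHom.lmul k (A ⊗[k] B))
          = (balancing (NonUnitalAlgHom.lmul k (A ⊗[k] B))).mkQ from LinearMap.congr_fun h t
      refine TensorProduct.ext_fourfold' fun a x c y => ?_
      change g ((a ⊗ₜ x) * (c ⊗ₜ y)) = _
      rw [Algebra.TensorProduct.tmul_mul_tmul]
      exact hg a c x y
    · intro t
      induction t with
      | zero => exact ⟨0, map_zero _⟩
      | add x y hx hy =>
        obtain ⟨x, rfl⟩ := hx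
        obtain ⟨y, rfl⟩ := hy
        exact ⟨x + y, map_add _ _ _⟩
      | tmul a x =>
        induction a using indA with
        | zero => exact ⟨0, by simp⟩
        | add a a' h h' =>
          obtain ⟨s, hs⟩ := h
          obtain ⟨s', hs'⟩ := h'
          exact ⟨s + s', by rw [map_add, hs, hs', TensorProduct.add_tmul]⟩
        | mul a c =>
          induction x using indB with
          | zero => exact ⟨0, by simp⟩
          | add a a' h h' =>
            obtain ⟨s, hs⟩ := h
            obtain ⟨s', hs'⟩ := h'
            exact ⟨s + s', by rw [map_add, hs, hs', TensorProduct.tmul_add]⟩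
          | mul x y =>
            exact ⟨Submodule.Quotient.mk ((a ⊗ₜ x) ⊗ₜ (c ⊗ₜ y)),
              Algebra.TensorProduct.tmul_mul_tmul a c x y⟩

end Tensor

/-! ### `G`-module algebras and smash products -/

section Smash

/-- A `G`-module algebra structure on `A`: an action of `G` by `k`-algebra automorphisms. -/
structure AlgAction (k G A : Type u) [CommRing k] [Group G] [NonUnitalRing A] [Module k A] where
  rho : Representation k G A
  map_mul : ∀ (g : G) (a b : A), rho g (a * b) = rho g a * rho g b

variable {k G A B : Type u} [CommRing k] [Group G]
  [NonUnitalRing A] [Module k A] [IsScalarTower k A A] [SMulCommClass k A A]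
  [NonUnitalRing B] [Module k B] [IsScalarTower k B B] [SMulCommClass k B B]

/-- The diagonal action `g(a ⊗ b) = ga ⊗ gb` on `A ⊗ B`. -/
def AlgAction.tensor (α : AlgAction k G A) (β : AlgAction k G B) :
    AlgAction k G (A ⊗[k] B) where
  rho := Representation.tprod α.rho β.rho
  map_mul g x y := by
    induction x with
    | zero => simp
    | add x x' hx hx' => rw [add_mul, map_add, hx, hx', map_add, add_mul]
    | tmul a b =>
      induction y with
      | zero => simp
      | add y y' hy hy' => rw [mul_add, map_add, hy, hy', map_add, mul_add]
      | tmul c d => simp [α.map_mul, β.map_mul]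

/-- The smash product `A # kG`, with elements the finite sums `∑ a_g # g`. -/
def Smash (_ : AlgAction k G A) : Type u := G →₀ A

namespace Smash

variable (α : AlgAction k G A)

instance : AddCommGroup (Smash α) := inferInstanceAs (AddCommGroup (G →₀ A))
instance : Module k (Smash α) := inferInstanceAs (Module k (G →₀ A))

/-- `of α g a` is the element `a # g` of the smash product. -/
def of (g : G) : A →ₗ[k] Smash α := (Finsupp.lsingle g : A →ₗ[k] (G →₀ A))

/-- Left multiplication by `a # g`, `b # h ↦ a(gb) # gh`. -/
def mulOf (g : G) : A →ₗ[k] Smash α →ₗ[k] Smash α :=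
  LinearMap.flip (Finsupp.lsum k fun h => LinearMap.flip
    (((LinearMap.mul k A).compl₂ (α.rho g)).compr₂ (of α (g * h))))

/-- The product of the smash product as a bilinear map, `(a # g)(b # h) = a(gb) # gh`. -/
def mulLin : Smash α →ₗ[k] Smash α →ₗ[k] Smash α :=
  Finsupp.lsum k fun g => mulOf α g

instance : Mul (Smash α) := ⟨fun x y => mulLin α x y⟩

theorem of_mul_of (g h : G) (a b : A) :
    of α g a * of α h b = of α (g * h) (a * α.rho g b) := by
  have h1 : mulLin α (of α g a) = mulOf α g a := Finsupp.lsum_single k _ g a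
  have h2 : mulOf α g a (of α h b) = of α (g * h) (a * α.rho g b) :=
    LinearMap.congr_fun (Finsupp.lsum_single k (fun h => LinearMap.flip
      (((LinearMap.mul k A).compl₂ (α.rho g)).compr₂ (of α (g * h)))) h b) a
  exact (LinearMap.congr_fun h1 _).trans h2

theorem induction {p : Smash α → Prop} (x : Smash α) (zero : p 0)
    (add : ∀ x y, p x → p y → p (x + y)) (of : ∀ g a, p (of α g a)) : p x :=
  Finsupp.induction_linear (motive := p) x zero add of

theorem left_distrib' (x y z : Smash α) : x * (y + z) = x * y + x * z :=
  map_add (mulLin α x) y z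

theorem right_distrib' (x y z : Smash α) : (x + y) * z = x * z + y * z :=
  LinearMap.map_add₂ (mulLin α) x y z

instance : NonUnitalRing (Smash α) where
  __ := (inferInstance : AddCommGroup (Smash α))
  left_distrib := left_distrib' α
  right_distrib := right_distrib' α
  zero_mul x := LinearMap.map_zero₂ (mulLin α) x
  mul_zero x := map_zero (mulLin α x)
  mul_assoc x y z := by
    have zm : ∀ x : Smash α, 0 * x = 0 := fun x => LinearMap.map_zero₂ (mulLin α) x
    have mz : ∀ x : Smash α, x * 0 = 0 := fun x => map_zero (mulLin α x)
    induction x using Smash.induction with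
    | zero => simp only [zm]
    | add x x' h h' => simp only [right_distrib', h, h']
    | of g a =>
      induction y using Smash.induction with
      | zero => simp only [zm, mz]
      | add x x' h h' => simp only [left_distrib', right_distrib', h, h']
      | of h b =>
        induction z using Smash.induction with
        | zero => simp only [mz]
        | add x x' h h' => simp only [left_distrib', h, h']
        | of l c => simp [of_mul_of, α.map_mul, mul_assoc]

instance : IsScalarTower k (Smash α) (Smash α) :=
  ⟨fun c x y => LinearMap.map_smul₂ (mulLin α) c x y⟩

instance : SMulCommClass k (Smash α) (Smash α) :=
  ⟨fun c x y => ((mulLin α x).map_smul c y).symm⟩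

/-- The algebra map `A → A # kG`, `a ↦ a # 1`. -/
def incl : A →ₙₐ[k] Smash α where
  toFun := of α 1
  map_smul' := (of α 1).map_smul
  map_zero' := (of α 1).map_zero
  map_add' := (of α 1).map_add
  map_mul' a b := by simp [of_mul_of]

end Smash

end Smash

/-! ### Graded algebras and the cotensor product -/

section Graded

/-- A family of submodules `S_g` of an algebra `S` with `1 ∈ S_e` and `S_g S_h ⊆ S_{gh}`. -/
structure Grading (k G S : Type u) [CommRing k] [Group G] [Ring S] [Algebra k S] where
  part : G → Submodule k S
  one_mem : (1 : S) ∈ part 1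
  mul_mem : ∀ {g h : G} {s t : S}, s ∈ part g → t ∈ part h → s * t ∈ part (g * h)

variable {k G S T : Type u} [CommRing k] [Group G]
  [Ring S] [Algebra k S] [Ring T] [Algebra k T]

open scoped Classical in
/-- `S`, with the submodules `S_g`, is a graded algebra: `S = ⨁ S_g`. -/
def Grading.IsGraded (𝒮 : Grading k G S) : Prop := DirectSum.IsInternal 𝒮.part

/-- The product `S_g × S_h → S_{gh}`. -/
def Grading.mulPart (𝒮 : Grading k G S) (g h : G) :
    𝒮.part g →ₗ[k] 𝒮.part h →ₗ[k] 𝒮.part (g * h) :=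
  LinearMap.mk₂ k (fun s t => ⟨s.1 * t.1, 𝒮.mul_mem s.2 t.2⟩)
    (fun _ _ _ => Subtype.ext (add_mul _ _ _)) (fun _ _ _ => Subtype.ext (smul_mul_assoc _ _ _))
    (fun _ _ _ => Subtype.ext (mul_add _ _ _)) (fun _ _ _ => Subtype.ext (mul_smul_comm _ _ _))

/-- The cotensor product `S □ T = ⨁ S_g ⊗ T_g`. -/
def Cotensor (𝒮 : Grading k G S) (𝒯 : Grading k G T) : Type u :=
  ⨁ g : G, (𝒮.part g ⊗[k] 𝒯.part g)

namespace Cotensor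

variable (𝒮 : Grading k G S) (𝒯 : Grading k G T)

instance : AddCommGroup (Cotensor 𝒮 𝒯) :=
  Module.addCommMonoidToAddCommGroup k (M := ⨁ g : G, (𝒮.part g ⊗[k] 𝒯.part g))
instance : Module k (Cotensor 𝒮 𝒯) :=
  inferInstanceAs (Module k (⨁ g : G, (𝒮.part g ⊗[k] 𝒯.part g)))

open scoped Classical in
/-- The inclusion of `S_g ⊗ T_g`. -/
def of (g : G) : 𝒮.part g ⊗[k] 𝒯.part g →ₗ[k] Cotensor 𝒮 𝒯 :=
  DirectSum.lof k G (fun g => 𝒮.part g ⊗[k] 𝒯.part g) g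

/-- The element `s ⊗ t` of `S □ T`, for `s ∈ S_g` and `t ∈ T_g`. -/
def tmul (g : G) (s : S) (hs : s ∈ 𝒮.part g) (t : T) (ht : t ∈ 𝒯.part g) : Cotensor 𝒮 𝒯 :=
  of 𝒮 𝒯 g (⟨s, hs⟩ ⊗ₜ ⟨t, ht⟩)

open scoped Classical in
/-- Left multiplication by `x ∈ S_g ⊗ T_g`. -/
def mulOf (g : G) : 𝒮.part g ⊗[k] 𝒯.part g →ₗ[k] Cotensor 𝒮 𝒯 →ₗ[k] Cotensor 𝒮 𝒯 :=
  LinearMap.flip <| DirectSum.toModule k G _ fun h => LinearMap.flip <|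
    (TensorProduct.map₂ (𝒮.mulPart g h) (𝒯.mulPart g h)).compr₂ (of 𝒮 𝒯 (g * h))

open scoped Classical in
/-- The product of `S □ T` as a bilinear map, `(s ⊗ t)(s' ⊗ t') = ss' ⊗ tt'`. -/
def mulLin : Cotensor 𝒮 𝒯 →ₗ[k] Cotensor 𝒮 𝒯 →ₗ[k] Cotensor 𝒮 𝒯 :=
  DirectSum.toModule k G _ fun g => mulOf 𝒮 𝒯 g

instance : Mul (Cotensor 𝒮 𝒯) := ⟨fun x y => mulLin 𝒮 𝒯 x y⟩

instance : One (Cotensor 𝒮 𝒯) := ⟨tmul 𝒮 𝒯 1 1 𝒮.one_mem 1 𝒯.one_mem⟩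

open scoped Classical in
theorem of_mul_of (g h : G) (x : 𝒮.part g ⊗[k] 𝒯.part g) (y : 𝒮.part h ⊗[k] 𝒯.part h) :
    of 𝒮 𝒯 g x * of 𝒮 𝒯 h y =
      of 𝒮 𝒯 (g * h) (TensorProduct.map₂ (𝒮.mulPart g h) (𝒯.mulPart g h) x y) := by
  have h1 : mulLin 𝒮 𝒯 (of 𝒮 𝒯 g x) = mulOf 𝒮 𝒯 g x :=
    DirectSum.toModule_lof (M := fun g : G => 𝒮.part g ⊗[k] 𝒯.part g)
      (φ := fun g => mulOf 𝒮 𝒯 g) k g x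
  have h2 : mulOf 𝒮 𝒯 g x (of 𝒮 𝒯 h y) =
      of 𝒮 𝒯 (g * h) (TensorProduct.map₂ (𝒮.mulPart g h) (𝒯.mulPart g h) x y) :=
    LinearMap.congr_fun (DirectSum.toModule_lof
      (M := fun h : G => 𝒮.part h ⊗[k] 𝒯.part h) (φ := fun h => LinearMap.flip <|
      (TensorProduct.map₂ (𝒮.mulPart g h) (𝒯.mulPart g h)).compr₂ (of 𝒮 𝒯 (g * h))) k h y) x
  exact (LinearMap.congr_fun h1 _).trans h2

theorem tmul_mul_tmul (g h : G) (s s' : S) (hs : s ∈ 𝒮.part g) (hs' : s' ∈ 𝒮.part h)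
    (t t' : T) (ht : t ∈ 𝒯.part g) (ht' : t' ∈ 𝒯.part h) :
    tmul 𝒮 𝒯 g s hs t ht * tmul 𝒮 𝒯 h s' hs' t' ht' =
      tmul 𝒮 𝒯 (g * h) (s * s') (𝒮.mul_mem hs hs') (t * t') (𝒯.mul_mem ht ht') :=
  of_mul_of 𝒮 𝒯 g h _ _

theorem tmul_congr {g g' : G} {s s' : S} {t t' : T} {hs : s ∈ 𝒮.part g} {ht : t ∈ 𝒯.part g}
    {hs' : s' ∈ 𝒮.part g'} {ht' : t' ∈ 𝒯.part g'} (hg : g = g') (h : s = s') (h' : t = t') :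
    tmul 𝒮 𝒯 g s hs t ht = tmul 𝒮 𝒯 g' s' hs' t' ht' := by
  subst hg h h'; rfl

theorem induction {p : Cotensor 𝒮 𝒯 → Prop} (x : Cotensor 𝒮 𝒯) (zero : p 0)
    (add : ∀ x y, p x → p y → p (x + y)) (tmul : ∀ g s hs t ht, p (tmul 𝒮 𝒯 g s hs t ht)) :
    p x := by
  classical
  refine DirectSum.induction_on (motive := p) x zero (fun g x => ?_) add
  change p (of 𝒮 𝒯 g x)
  induction x with
  | zero => rw [map_zero]; exact zero
  | add x y hx hy => rw [map_add]; exact add _ _ hx hy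
  | tmul s t => exact tmul g s.1 s.2 t.1 t.2

theorem left_distrib' (x y z : Cotensor 𝒮 𝒯) : x * (y + z) = x * y + x * z :=
  map_add (mulLin 𝒮 𝒯 x) y z

theorem right_distrib' (x y z : Cotensor 𝒮 𝒯) : (x + y) * z = x * z + y * z :=
  LinearMap.map_add₂ (mulLin 𝒮 𝒯) x y z

theorem zero_mul' (x : Cotensor 𝒮 𝒯) : 0 * x = 0 := LinearMap.map_zero₂ (mulLin 𝒮 𝒯) x

theorem mul_zero' (x : Cotensor 𝒮 𝒯) : x * 0 = 0 := map_zero (mulLin 𝒮 𝒯 x)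

theorem one_def : (1 : Cotensor 𝒮 𝒯) = tmul 𝒮 𝒯 1 1 𝒮.one_mem 1 𝒯.one_mem := rfl

instance : Ring (Cotensor 𝒮 𝒯) where
  __ := (inferInstance : AddCommGroup (Cotensor 𝒮 𝒯))
  left_distrib := left_distrib' 𝒮 𝒯
  right_distrib := right_distrib' 𝒮 𝒯
  zero_mul := zero_mul' 𝒮 𝒯
  mul_zero := mul_zero' 𝒮 𝒯
  mul_assoc x y z := by
    induction x using Cotensor.induction with
    | zero => simp only [zero_mul']
    | add x x' h h' => simp only [right_distrib', h, h']
    | tmul g s hs t ht =>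
      induction y using Cotensor.induction with
      | zero => simp only [zero_mul', mul_zero']
      | add x x' h h' => simp only [left_distrib', right_distrib', h, h']
      | tmul g s hs t ht =>
        induction z using Cotensor.induction with
        | zero => simp only [mul_zero']
        | add x x' h h' => simp only [left_distrib', h, h']
        | tmul g s hs t ht =>
          simp only [tmul_mul_tmul]
          exact tmul_congr _ _ (mul_assoc _ _ _) (mul_assoc _ _ _) (mul_assoc _ _ _)
  one_mul x := by
    induction x using Cotensor.induction with
    | zero => exact mul_zero' _ _ _
    | add x x' h h' => rw [left_distrib', h, h']
    | tmul g s hs t ht =>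
      rw [one_def, tmul_mul_tmul]
      exact tmul_congr _ _ (one_mul _) (one_mul _) (one_mul _)
  mul_one x := by
    induction x using Cotensor.induction with
    | zero => exact zero_mul' _ _ _
    | add x x' h h' => rw [right_distrib', h, h']
    | tmul g s hs t ht =>
      rw [one_def, tmul_mul_tmul]
      exact tmul_congr _ _ (mul_one _) (mul_one _) (mul_one _)
  neg_add_cancel x := neg_add_cancel x
  zsmul := (· • ·)
  zsmul_zero' := zero_zsmul
  zsmul_succ' := fun n a => by simp [add_zsmul]
  zsmul_neg' := fun n a => by simp [add_zsmul, Int.negSucc_eq]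

instance : Algebra k (Cotensor 𝒮 𝒯) :=
  Algebra.ofModule (fun c x y => LinearMap.map_smul₂ (mulLin 𝒮 𝒯) c x y)
    (fun c x y => (mulLin 𝒮 𝒯 x).map_smul c y)

/-- The grading of `S □ T`: the part of degree `g` is `S_g ⊗ T_g`. -/
def grading : Grading k G (Cotensor 𝒮 𝒯) where
  part g := LinearMap.range (of 𝒮 𝒯 g)
  one_mem := ⟨_, rfl⟩
  mul_mem := by
    rintro g h _ _ ⟨x, rfl⟩ ⟨y, rfl⟩
    exact ⟨_, (of_mul_of 𝒮 𝒯 g h x y).symm⟩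

end Cotensor

end Graded

/-! ### The graded algebra `Hom_{Aᵉ}(A, A # kG)` -/

section Hom

variable {k G A : Type u} [CommRing k] [Group G]
  [NonUnitalRing A] [Module k A] [IsScalarTower k A A] [SMulCommClass k A A]

/-- `Hom_{Aᵉ}(A, A # kG)`. -/
abbrev SmashHom (α : AlgAction k G A) : Type u := EnvHom (Smash.incl α)

/-- The grading of `Hom_{Aᵉ}(A, A # kG)`: a homomorphism `f` is of degree `g` if `f(A) ⊆ A # g`. -/
def smashHomGrading [IsUnitalAlgebra k A] (α : AlgAction k G A) :
    Grading k G (SmashHom α) where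
  part g := {
    carrier := {f | ∀ a : A, f.1 a ∈ LinearMap.range (Smash.of α g)}
    add_mem' := fun hf hg a => add_mem (hf a) (hg a)
    zero_mem' := fun _ => zero_mem _
    smul_mem' := fun c _ hf a => Submodule.smul_mem _ c (hf a) }
  one_mem a := ⟨a, rfl⟩
  mul_mem {g h φ ψ} hφ hψ x := by
    have indA : ∀ {p : A → Prop} (x : A) (zero : p 0) (mul : ∀ a b, p (a * b))
        (add : ∀ x y, p x → p y → p (x + y)), p x :=
      fun x zero mul add => mul_induction (k := k) x zero mul add
    induction x using indA with
    | zero => rw [map_zero]; exact zero_mem _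
    | add x y hx hy => rw [map_add]; exact add_mem hx hy
    | mul a b =>
      obtain ⟨u, hu⟩ := hφ a
      obtain ⟨v, hv⟩ := hψ b
      rw [EnvHom.mul_apply, ← hu, ← hv, Smash.of_mul_of]
      exact ⟨_, rfl⟩

end Hom

/-- An isomorphism of `G`-graded algebras. -/
structure GradedAlgEquiv {k G S T : Type u} [CommRing k] [Group G]
    [Ring S] [Algebra k S] [Ring T] [Algebra k T]
    (𝒮 : Grading k G S) (𝒯 : Grading k G T) extends S ≃ₐ[k] T where
  map_part : ∀ (g : G) (s : S), s ∈ 𝒮.part g ↔ toFun s ∈ 𝒯.part g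

end TaylorAzumaya

end

/-!
Over a Taylor–Azumaya algebra `A` the functor `Hom_{Aᵉ}(A, -)` inverts `A ⊗ -` on unital modules.
Each summand `A # g` of `A # kG` is a unital `Aᵉ`-module, hence `A ⊗ H_g ≅ A # g` for
`H_g = Hom_{Aᵉ}(A, A # g)`. Summing over `g` gives `A ⊗ ⨁ H_g ≅ A # kG`, and applying
`Hom_{Aᵉ}(A, -)` gives `⨁ H_g ≅ Hom_{Aᵉ}(A, A # kG)`.

The unit of the adjunction for `A ⊗ B` is an isomorphism because it is for `A` and for `B`: a
bimodule map out of `A ⊗ B` is linear in each variable separately. Tensoring `A ⊗ H_g ≅ A # g` with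
its analogue for `B` gives `(A ⊗ B) ⊗ (H_g ⊗ H'_g) ≅ (A ⊗ B) # g`, so the same argument identifies
`⨁ H_g ⊗ H'_g` with `Hom_{(A ⊗ B)ᵉ}(A ⊗ B, (A ⊗ B) # kG)`.
-/

noncomputable section

namespace TaylorAzumaya

open MulOpposite (op)

section ModuleHom

variable {k R S M M' T : Type u} [CommRing k]
  [NonUnitalRing R] [Module k R] [NonUnitalRing S] [Module k S]
  [AddCommGroup M] [Module k M] [AddCommGroup M'] [Module k M'] [AddCommGroup T] [Module k T]

theorem mkQ_mul_tmul (ρ : R →ₙₐ[k] Module.End k M) (r s : R) (m : M) :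
    (balancing ρ).mkQ ((r * s) ⊗ₜ m) = (balancing ρ).mkQ (r ⊗ₜ ρ s m) :=
  (Submodule.Quotient.eq _).2 (Submodule.subset_span ⟨r, s, m, rfl⟩)

theorem ext_on_act {ρ : R →ₙₐ[k] Module.End k M} (hρ : Function.Surjective (actMap ρ))
    {f g : M →ₗ[k] T} (h : ∀ r m, f (ρ r m) = g (ρ r m)) : f = g :=
  LinearMap.cancel_right hρ |>.1 (TensorProduct.ext' h)

/-- Expand `m = r'm₀` and `m' = sm₀'`; then both sides equal `(rr')s(F m₀ m₀')`. -/
theorem map_act_left_of_map_act_act {ρ : R →ₙₐ[k] Module.End k M} {σ : S →ₙₐ[k] Module.End k M'}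
    (hρ : Function.Surjective (actMap ρ)) (hσ : Function.Surjective (actMap σ))
    {τ : R →ₙₐ[k] Module.End k T} {υ : S → Module.End k T} {F : M →ₗ[k] M' →ₗ[k] T}
    (hF : ∀ r s m m', F (ρ r m) (σ s m') = τ r (υ s (F m m'))) (r : R) (m : M) (m' : M') :
    F (ρ r m) m' = τ r (F m m') := by
  suffices h : F ∘ₗ ρ r = F.compr₂ (τ r) from LinearMap.congr_fun₂ h m m'
  refine ext_on_act hρ fun r' m₀ => ext_on_act hσ fun s m₀' => ?_
  calc F (ρ r (ρ r' m₀)) (σ s m₀') = F (ρ (r * r') m₀) (σ s m₀') := by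
        rw [map_mul, Module.End.mul_apply]
    _ = τ r (F (ρ r' m₀) (σ s m₀')) := by rw [hF, hF, map_mul, Module.End.mul_apply]

end ModuleHom

section UnitalAlgebra

variable {k A : Type u} [CommRing k]
  [NonUnitalRing A] [Module k A] [IsScalarTower k A A] [SMulCommClass k A A]
  {M M' : Type u} [AddCommGroup M] [Module k M] [AddCommGroup M'] [Module k M']

theorem mem_moduleHom_of_tmul {ρ : A ⊗[k] Aᵐᵒᵖ →ₙₐ[k] Module.End k M}
    {ρ' : A ⊗[k] Aᵐᵒᵖ →ₙₐ[k] Module.End k M'} {f : M →ₗ[k] M'}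
    (h : ∀ a a' m, f (ρ (a ⊗ₜ op a') m) = ρ' (a ⊗ₜ op a') (f m)) : f ∈ moduleHom ρ ρ' := by
  intro r m
  induction r with
  | zero => simp only [map_zero, LinearMap.zero_apply]
  | add r s hr hs => simp only [map_add, LinearMap.add_apply, hr, hs]
  | tmul a a' => exact h a a'.unop m

theorem counitMap_mem_moduleHom (ρ : A ⊗[k] Aᵐᵒᵖ →ₙₐ[k] Module.End k M) :
    counitMap k A ρ ∈ moduleHom (tensorAct (selfAct k A) (moduleHom (selfAct k A) ρ)) ρ :=
  fun r => LinearMap.congr_fun <| show counitMap k A ρ ∘ₗ (selfAct k A r).rTensor _ =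
    ρ r ∘ₗ counitMap k A ρ from TensorProduct.ext' fun a f => f.2 r a

theorem lTensor_mem_moduleHom (ρ : A ⊗[k] Aᵐᵒᵖ →ₙₐ[k] Module.End k A) (f : M →ₗ[k] M') :
    f.lTensor A ∈ moduleHom (tensorAct ρ M) (tensorAct ρ M') :=
  fun r => LinearMap.congr_fun <| show f.lTensor A ∘ₗ (ρ r).rTensor M =
    (ρ r).rTensor M' ∘ₗ f.lTensor A by
      rw [LinearMap.lTensor_comp_rTensor, LinearMap.rTensor_comp_lTensor]

theorem comp_mem_moduleHom {R M'' : Type u} [NonUnitalRing R] [Module k R]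
    [AddCommGroup M''] [Module k M''] {ρ : R →ₙₐ[k] Module.End k M}
    {ρ' : R →ₙₐ[k] Module.End k M'} {ρ'' : R →ₙₐ[k] Module.End k M''}
    {g : M' →ₗ[k] M''} {f : M →ₗ[k] M'} (hg : g ∈ moduleHom ρ' ρ'') (hf : f ∈ moduleHom ρ ρ') :
    g ∘ₗ f ∈ moduleHom ρ ρ'' := fun r m => by
  rw [LinearMap.comp_apply, hf, hg, LinearMap.comp_apply]

/-- If `M` is of the form `A ⊗ N`, then `Hom_{Aᵉ}(A, M)` is `N`. -/
def homEquivOfTensorEquiv {N : Type u} [AddCommGroup N] [Module k N]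
    (hN : Function.Bijective (unitMap k A N)) {ρ : A ⊗[k] Aᵐᵒᵖ →ₙₐ[k] Module.End k M}
    (E : A ⊗[k] N ≃ₗ[k] M) (hE : E.toLinearMap ∈ moduleHom (tensorAct (selfAct k A) N) ρ) :
    N ≃ₗ[k] moduleHom (selfAct k A) ρ :=
  have hE' : E.symm.toLinearMap ∈ moduleHom ρ (tensorAct (selfAct k A) N) := fun r m => by
    rw [LinearEquiv.coe_coe, E.symm_apply_eq, ← LinearEquiv.coe_coe E, hE]
    simp only [LinearEquiv.coe_coe, E.apply_symm_apply]
  LinearEquiv.ofBijective (unitMap k A N) hN ≪≫ₗ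
    { toFun f := ⟨E.toLinearMap ∘ₗ f.1, comp_mem_moduleHom hE f.2⟩
      invFun f := ⟨E.symm.toLinearMap ∘ₗ f.1, comp_mem_moduleHom hE' f.2⟩
      map_add' f g := Subtype.ext (LinearMap.comp_add _ _ _)
      map_smul' c f := Subtype.ext (LinearMap.comp_smul _ _ _)
      left_inv f := by ext; simp
      right_inv f := by ext; simp }

variable [IsUnitalAlgebra k A]

theorem ext_on_mul_mul {f g : A →ₗ[k] M} (h : ∀ a b c, f (a * (b * c)) = g (a * (b * c))) :
    f = g := by
  refine ext_on_mul fun a b => ?_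
  have : f ∘ₗ LinearMap.mulLeft k a = g ∘ₗ LinearMap.mulLeft k a := ext_on_mul (h a)
  exact LinearMap.congr_fun this b

variable (k A) in
theorem actMap_selfAct_surjective : Function.Surjective (actMap (selfAct k A)) := by
  rw [← LinearMap.range_eq_top, ← Submodule.ker_mkQ (LinearMap.range _), LinearMap.ker_eq_top]
  refine ext_on_mul_mul fun a b c => ?_
  exact (Submodule.Quotient.mk_eq_zero _).2 ⟨(a ⊗ₜ op c) ⊗ₜ b, rfl⟩

/-- The map `A ≅ A ⊗_A A → M` induced by a balanced bilinear map `f`. -/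
def liftMul (f : A →ₗ[k] A →ₗ[k] M) (hf : ∀ a b c, f (a * b) c = f a (b * c)) : A →ₗ[k] M :=
  (balancing (NonUnitalAlgHom.lmul k A)).liftQ (TensorProduct.lift f) (by
      refine Submodule.span_le.2 ?_
      rintro _ ⟨a, b, c, rfl⟩
      simp [hf])
    ∘ₗ (LinearEquiv.ofBijective _ (IsUnitalAlgebra.unital (k := k) (A := A))).symm.toLinearMap

theorem liftMul_mul (f : A →ₗ[k] A →ₗ[k] M) (hf : ∀ a b c, f (a * b) c = f a (b * c)) (a b : A) :
    liftMul f hf (a * b) = f a b := by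
  have h : (LinearEquiv.ofBijective _ (IsUnitalAlgebra.unital (k := k) (A := A))).symm (a * b)
      = Submodule.Quotient.mk (a ⊗ₜ b) := by
    rw [LinearEquiv.symm_apply_eq]; rfl
  rw [liftMul, LinearMap.comp_apply, LinearEquiv.coe_coe, h]
  rfl

theorem exists_lift_mul_mul (f : A →ₗ[k] A →ₗ[k] A →ₗ[k] M)
    (hl : ∀ a b c d, f (b * c) d a = f c d (a * b))
    (hr : ∀ a b c d, f (b * c) d a = f b (c * d) a) :
    ∃ F : A →ₗ[k] M, ∀ a b c, F (a * (b * c)) = f b c a := by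
  let H : A →ₗ[k] A →ₗ[k] M := liftMul f fun b c d => LinearMap.ext fun a => hr a b c d
  have hH : ∀ b c, H (b * c) = f b c := liftMul_mul f _
  have balanced : ∀ a b x, H.flip (a * b) x = H.flip a (b * x) := fun a b x => by
    suffices h : H.flip (a * b) = H.flip a ∘ₗ LinearMap.mulLeft k b from LinearMap.congr_fun h x
    refine ext_on_mul fun c d => ?_
    simp only [LinearMap.flip_apply, LinearMap.comp_apply, LinearMap.mulLeft_apply]
    rw [← mul_assoc, hH, hH, hl]
  exact ⟨liftMul H.flip balanced, fun a b c => by rw [liftMul_mul, LinearMap.flip_apply, hH]⟩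

end UnitalAlgebra

section Smash

variable {k G A : Type u} [CommRing k] [Group G] [NonUnitalRing A] [Module k A]

namespace Smash

/-- The coefficient of `g` in an element of the smash product. -/
def coef (α : AlgAction k G A) (g : G) : Smash α →ₗ[k] A :=
  (Finsupp.lapply g : (G →₀ A) →ₗ[k] A)

theorem coef_of (α : AlgAction k G A) (g : G) (a : A) : coef α g (of α g a) = a :=
  Finsupp.single_eq_same

theorem coef_of_ne (α : AlgAction k G A) {g h : G} (hgh : g ≠ h) (a : A) :
    coef α h (of α g a) = 0 := Finsupp.single_eq_of_ne' hgh

theorem ext_coef {α : AlgAction k G A} {s t : Smash α} (h : ∀ g, coef α g s = coef α g t) :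
    s = t := Finsupp.ext h

theorem mem_range_of {α : AlgAction k G A} {g : G} {s : Smash α} :
    s ∈ LinearMap.range (of α g) ↔ of α g (coef α g s) = s :=
  ⟨by rintro ⟨a, rfl⟩; rw [coef_of], fun h => ⟨_, h⟩⟩

variable [IsScalarTower k A A] [SMulCommClass k A A]

theorem envAct_of (α : AlgAction k G A) (g : G) (a a' b : A) :
    envAct (incl α) (a ⊗ₜ op a') (of α g b) = of α g (a * (b * α.rho g a')) := by
  change of α 1 a * (of α g b * of α 1 a') = _
  rw [of_mul_of, of_mul_of, mul_one, one_mul, map_one, Module.End.one_apply]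

theorem of_coef_envAct_of (α : AlgAction k G A) (g : G) (r : A ⊗[k] Aᵐᵒᵖ) (b : A) :
    of α g (coef α g (envAct (incl α) r (of α g b))) = envAct (incl α) r (of α g b) := by
  induction r with
  | zero => simp only [map_zero, LinearMap.zero_apply]
  | add r s hr hs => simp only [map_add, LinearMap.add_apply, hr, hs]
  | tmul a a' => rw [← MulOpposite.op_unop a', envAct_of, coef_of]

end Smash

variable [IsScalarTower k A A] [SMulCommClass k A A]

/-- The `Aᵉ`-module `A # g`, on the underlying `k`-module `A`. -/
def twistAct (α : AlgAction k G A) (g : G) : A ⊗[k] Aᵐᵒᵖ →ₙₐ[k] Module.End k A where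
  toFun r := Smash.coef α g ∘ₗ envAct (Smash.incl α) r ∘ₗ Smash.of α g
  map_smul' c r := by ext b; simp
  map_zero' := by ext b; simp
  map_add' r s := by ext b; simp
  map_mul' r s := by ext b; simp [Smash.of_coef_envAct_of]

theorem twistAct_tmul (α : AlgAction k G A) (g : G) (a a' b : A) :
    twistAct α g (a ⊗ₜ op a') b = a * (b * α.rho g a') := by
  change Smash.coef α g (envAct (Smash.incl α) (a ⊗ₜ op a') (Smash.of α g b)) = _
  rw [Smash.envAct_of, Smash.coef_of]

theorem Smash.of_mem_moduleHom (α : AlgAction k G A) (g : G) :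
    Smash.of α g ∈ moduleHom (twistAct α g) (envAct (Smash.incl α)) :=
  Smash.of_coef_envAct_of α g

theorem Smash.coef_mem_moduleHom (α : AlgAction k G A) (g : G) :
    Smash.coef α g ∈ moduleHom (envAct (Smash.incl α)) (twistAct α g) := by
  refine mem_moduleHom_of_tmul fun a a' s => ?_
  induction s using Smash.induction with
  | zero => simp only [map_zero]
  | add x y hx hy => simp only [map_add, hx, hy]
  | of h b =>
    rw [Smash.envAct_of, twistAct_tmul]
    obtain rfl | hgh := eq_or_ne h g
    · rw [Smash.coef_of, Smash.coef_of]
    · rw [Smash.coef_of_ne _ hgh, Smash.coef_of_ne _ hgh, zero_mul, mul_zero]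

theorem mkQ_twistAct_move_left [IsUnitalAlgebra k A] (α : AlgAction k G A) (g : G) (x y c b : A) :
    (balancing (twistAct α g)).mkQ (((x * y) ⊗ₜ op c) ⊗ₜ b) =
      (balancing (twistAct α g)).mkQ ((x ⊗ₜ op c) ⊗ₜ (y * b)) := by
  refine mul_induction (k := k) x (by simp) (fun x₁ x₂ => ?_)
    (fun x x' h h' => by simp only [add_mul, TensorProduct.add_tmul, map_add, h, h'])
  refine mul_induction (k := k) c (by simp) (fun c₁ c₂ => ?_) (fun c c' h h' => by
    simp only [MulOpposite.op_add, TensorProduct.add_tmul, TensorProduct.tmul_add, map_add, h, h'])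
  have h₁ := mkQ_mul_tmul (twistAct α g) (x₁ ⊗ₜ op c₂) ((x₂ * y) ⊗ₜ op c₁) b
  have h₂ := mkQ_mul_tmul (twistAct α g) (x₁ ⊗ₜ op c₂) (x₂ ⊗ₜ op c₁) (y * b)
  rw [Algebra.TensorProduct.tmul_mul_tmul, ← MulOpposite.op_mul, twistAct_tmul] at h₁ h₂
  rw [mul_assoc x₁, h₁, h₂]
  simp only [mul_assoc]

theorem mkQ_twistAct_move_right [IsUnitalAlgebra k A] (α : AlgAction k G A) (g : G) (x y c b : A) :
    (balancing (twistAct α g)).mkQ ((x ⊗ₜ op (y * c)) ⊗ₜ b) =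
      (balancing (twistAct α g)).mkQ ((x ⊗ₜ op c) ⊗ₜ (b * α.rho g y)) := by
  refine mul_induction (k := k) x (by simp) (fun x₁ x₂ => ?_)
    (fun x x' h h' => by simp only [TensorProduct.add_tmul, map_add, h, h'])
  refine mul_induction (k := k) c (by simp) (fun c₁ c₂ => ?_) (fun c c' h h' => by
    simp only [mul_add, MulOpposite.op_add, TensorProduct.add_tmul, TensorProduct.tmul_add,
      map_add, h, h'])
  have h₁ := mkQ_mul_tmul (twistAct α g) (x₁ ⊗ₜ op c₂) (x₂ ⊗ₜ op (y * c₁)) b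
  have h₂ := mkQ_mul_tmul (twistAct α g) (x₁ ⊗ₜ op c₂) (x₂ ⊗ₜ op c₁) (b * α.rho g y)
  rw [Algebra.TensorProduct.tmul_mul_tmul, ← MulOpposite.op_mul, twistAct_tmul] at h₁ h₂
  rw [← mul_assoc y, h₁, h₂, α.map_mul]
  simp only [mul_assoc]

/-- The inverse `A # g → Aᵉ ⊗_{Aᵉ} (A # g)` sends `abc # g` to `(a ⊗ g⁻¹c) ⊗ (b # g)`. -/
theorem isUnitalModule_twistAct [IsUnitalAlgebra k A] (α : AlgAction k G A) (g : G) :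
    IsUnitalModule (twistAct α g) := by
  let q := (balancing (twistAct α g)).mkQ
  let f : A →ₗ[k] A →ₗ[k] A →ₗ[k] RelTensor (twistAct α g) := LinearMap.mk₂ k
    (fun b c => q ∘ₗ (TensorProduct.mk k (A ⊗[k] Aᵐᵒᵖ) A).flip b ∘ₗ
      (TensorProduct.mk k A Aᵐᵒᵖ).flip (op (α.rho g⁻¹ c)))
    (fun b b' c => by ext; simp) (fun r b c => by ext; simp)
    (fun b c c' => by ext; simp) (fun r b c => by ext; simp)
  have hf : ∀ b c a, f b c a = q ((a ⊗ₜ op (α.rho g⁻¹ c)) ⊗ₜ b) := fun _ _ _ => rfl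
  obtain ⟨F, hF⟩ := exists_lift_mul_mul f
    (fun a b c d => (mkQ_twistAct_move_left α g a b _ c).symm)
    (fun a b c d => by
      rw [hf, hf, α.map_mul, mkQ_twistAct_move_right, α.rho.self_inv_apply])
  refine Function.bijective_iff_has_inverse.2 ⟨F, fun t => ?_, fun x => ?_⟩
  · obtain ⟨t, rfl⟩ := Submodule.Quotient.mk_surjective _ t
    suffices h : F ∘ₗ actMap (twistAct α g) = q from LinearMap.congr_fun h t
    refine TensorProduct.ext_threefold fun a c b => ?_
    rw [LinearMap.comp_apply, actMap_tmul, ← MulOpposite.op_unop c, twistAct_tmul, hF, hf,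
      α.rho.inv_self_apply]
  · suffices h : relAct (twistAct α g) ∘ₗ F = LinearMap.id from LinearMap.congr_fun h x
    refine ext_on_mul_mul fun a b c => ?_
    rw [LinearMap.comp_apply, hF, hf, LinearMap.id_apply]
    change twistAct α g (a ⊗ₜ op (α.rho g⁻¹ c)) b = _
    rw [twistAct_tmul, α.rho.self_inv_apply]

end Smash

section TensorUnit

variable {k A B N : Type u} [CommRing k]
  [NonUnitalRing A] [Module k A] [IsScalarTower k A A] [SMulCommClass k A A]
  [NonUnitalRing B] [Module k B] [IsScalarTower k B B] [SMulCommClass k B B]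
  [AddCommGroup N] [Module k N]

theorem selfAct_tmul_tmul (a a' : A) (b b' : B) :
    selfAct k (A ⊗[k] B) ((a ⊗ₜ b) ⊗ₜ op (a' ⊗ₜ b')) =
      TensorProduct.map (selfAct k A (a ⊗ₜ op a')) (selfAct k B (b ⊗ₜ op b')) :=
  TensorProduct.ext' fun x y => by simp [Algebra.TensorProduct.tmul_mul_tmul]

theorem assoc_map_selfAct_tmul {f : A ⊗[k] B →ₗ[k] (A ⊗[k] B) ⊗[k] N}
    (hf : ∀ r t, f (selfAct k (A ⊗[k] B) r t) = (selfAct k (A ⊗[k] B) r).rTensor N (f t))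
    (r : A ⊗[k] Aᵐᵒᵖ) (s : B ⊗[k] Bᵐᵒᵖ) (x : A) (y : B) :
    TensorProduct.assoc k A B N (f (selfAct k A r x ⊗ₜ selfAct k B s y)) =
      tensorAct (selfAct k A) (B ⊗[k] N) r
        ((tensorAct (selfAct k B) N s).lTensor A (TensorProduct.assoc k A B N (f (x ⊗ₜ y)))) := by
  induction r with
  | zero => simp only [map_zero, LinearMap.zero_apply, TensorProduct.zero_tmul]
  | add r r' h h' => simp only [map_add, LinearMap.add_apply, TensorProduct.add_tmul, h, h']
  | tmul a a' =>
    induction s with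
    | zero => simp only [map_zero, LinearMap.zero_apply, TensorProduct.tmul_zero,
        LinearMap.lTensor_zero]
    | add s s' h h' => simp only [map_add, LinearMap.add_apply, TensorProduct.tmul_add,
        LinearMap.lTensor_add, h, h']
    | tmul b b' =>
      have selfAct_eq_map := selfAct_tmul_tmul (k := k) a a'.unop b b'.unop
      have assoc_comm : ∀ (p : Module.End k A) (q : Module.End k B),
          (TensorProduct.assoc k A B N).toLinearMap ∘ₗ (TensorProduct.map p q).rTensor N =
            p.rTensor (B ⊗[k] N) ∘ₗ (q.rTensor N).lTensor A ∘ₗ TensorProduct.assoc k A B N :=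
        fun p q => TensorProduct.ext_threefold fun _ _ _ => rfl
      rw [← TensorProduct.map_tmul, ← MulOpposite.op_unop a', ← MulOpposite.op_unop b',
        ← selfAct_eq_map, hf, selfAct_eq_map]
      exact LinearMap.congr_fun (assoc_comm _ _) (f (x ⊗ₜ y))

theorem exists_assoc_map_tmul [IsUnitalAlgebra k A] [IsUnitalAlgebra k B]
    (hA : Function.Bijective (unitMap k A (B ⊗[k] N)))
    {f : A ⊗[k] B →ₗ[k] (A ⊗[k] B) ⊗[k] N}
    (hf : ∀ r t, f (selfAct k (A ⊗[k] B) r t) = (selfAct k (A ⊗[k] B) r).rTensor N (f t)) :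
    ∃ T ∈ moduleHom (selfAct k B) (tensorAct (selfAct k B) N),
      ∀ a b, TensorProduct.assoc k A B N (f (a ⊗ₜ b)) = a ⊗ₜ T b := by
  let F : A →ₗ[k] B →ₗ[k] A ⊗[k] (B ⊗[k] N) :=
    TensorProduct.curry ((TensorProduct.assoc k A B N).toLinearMap ∘ₗ f)
  have hF : ∀ r s a b, F (selfAct k A r a) (selfAct k B s b) =
      tensorAct (selfAct k A) _ r ((tensorAct (selfAct k B) N s).lTensor A (F a b)) :=
    assoc_map_selfAct_tmul hf
  have hFA : ∀ b, F.flip b ∈ moduleHom (selfAct k A) (tensorAct (selfAct k A) (B ⊗[k] N)) :=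
    fun b r a => map_act_left_of_map_act_act (υ := fun s => (tensorAct (selfAct k B) N s).lTensor A)
      (actMap_selfAct_surjective k A) (actMap_selfAct_surjective k B) hF r a b
  let T : B →ₗ[k] B ⊗[k] N :=
    (LinearEquiv.ofBijective _ hA).symm.toLinearMap ∘ₗ F.flip.codRestrict _ hFA
  have unitMap_T : ∀ b, unitMap k A (B ⊗[k] N) (T b) = ⟨F.flip b, hFA b⟩ := fun b =>
    (LinearEquiv.ofBijective _ hA).apply_symm_apply ⟨F.flip b, hFA b⟩
  have F_eq : ∀ a b, F a b = a ⊗ₜ T b := fun a b =>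
    (LinearMap.congr_fun (congrArg Subtype.val (unitMap_T b)) a).symm
  refine ⟨T, fun s b => hA.1 (Subtype.ext ?_), F_eq⟩
  refine ext_on_act (actMap_selfAct_surjective k A) fun r a => ?_
  calc selfAct k A r a ⊗ₜ T (selfAct k B s b) = F (selfAct k A r a) (selfAct k B s b) :=
        (F_eq _ _).symm
    _ = selfAct k A r a ⊗ₜ tensorAct (selfAct k B) N s (T b) := by rw [hF, F_eq]; rfl

theorem unitMap_tensor_bijective [IsUnitalAlgebra k A] [IsUnitalAlgebra k B]
    (hA : Function.Bijective (unitMap k A (B ⊗[k] N))) (hB : Function.Bijective (unitMap k B N)) :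
    Function.Bijective (unitMap k (A ⊗[k] B) N) := by
  refine ⟨fun n n' h => ?_, fun f => ?_⟩
  · have tmul_eq : ∀ b : B, b ⊗ₜ[k] n = b ⊗ₜ n' := fun b =>
      hA.1 <| Subtype.ext <| LinearMap.ext fun a => congrArg (TensorProduct.assoc k A B N)
        (LinearMap.congr_fun (congrArg Subtype.val h) (a ⊗ₜ b))
    exact hB.1 (Subtype.ext (LinearMap.ext tmul_eq))
  · obtain ⟨T, hT, f_eq⟩ := exists_assoc_map_tmul hA f.2
    obtain ⟨n, hn⟩ := hB.2 ⟨T, hT⟩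
    refine ⟨n, Subtype.ext (TensorProduct.ext' fun a b => ?_)⟩
    have T_eq : b ⊗ₜ n = T b := LinearMap.congr_fun (congrArg Subtype.val hn) b
    exact (TensorProduct.assoc k A B N).injective ((f_eq a b).trans (by rw [← T_eq]; rfl)).symm

end TensorUnit

open scoped Classical in
theorem isInternal_range_comp_lof {R ι M : Type*} {N : ι → Type*} [Semiring R]
    [∀ i, AddCommMonoid (N i)] [∀ i, Module R (N i)] [AddCommMonoid M] [Module R M]
    (Θ : (⨁ i, N i) ≃ₗ[R] M) :
    DirectSum.IsInternal fun i => LinearMap.range (Θ.toLinearMap ∘ₗ DirectSum.lof R ι N i) := by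
  let e : ∀ i, N i ≃ₗ[R] LinearMap.range (Θ.toLinearMap ∘ₗ DirectSum.lof R ι N i) := fun i =>
    LinearEquiv.ofInjective _ (Θ.injective.comp (DirectSum.of_injective i))
  have coe_comp_mapRange :
      DirectSum.coeLinearMap _ ∘ₗ (DFinsupp.mapRange.linearEquiv e).toLinearMap =
        Θ.toLinearMap := DirectSum.linearMap_ext R fun i => LinearMap.ext fun n => by
    have mapRange_lof : DFinsupp.mapRange.linearEquiv e (DirectSum.lof R ι N i n) =
        DirectSum.lof R ι _ i (e i n) :=
      DFinsupp.mapRange_single (hf := fun i => map_zero (e i))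
    simp only [LinearMap.comp_apply, LinearEquiv.coe_coe]
    rw [mapRange_lof, DirectSum.coeLinearMap_lof]
    rfl
  have coe_eq : ⇑(DirectSum.coeLinearMap fun i => LinearMap.range (Θ.toLinearMap ∘ₗ
      DirectSum.lof R ι N i)) = Θ ∘ (DFinsupp.mapRange.linearEquiv e).symm := by
    rw [LinearEquiv.eq_comp_symm]
    exact congrArg DFunLike.coe coe_comp_mapRange
  change Function.Bijective (DirectSum.coeLinearMap _)
  rw [coe_eq]
  exact Θ.bijective.comp (LinearEquiv.bijective _)

section SmashHom

variable {k G C : Type u} [CommRing k] [Group G]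
  [NonUnitalRing C] [Module k C] [IsScalarTower k C C] [SMulCommClass k C C]
  {γ : AlgAction k G C} {N : G → Type u} [∀ g, AddCommGroup (N g)] [∀ g, Module k (N g)]

open scoped Classical in
/-- The isomorphism `C ⊗ ⨁ N_g ≅ C # kG` with components `C ⊗ N_g ≅ C # g`. -/
def tensorDirectSumEquivSmash (γ : AlgAction k G C) (e : ∀ g, C ⊗[k] N g ≃ₗ[k] C) :
    C ⊗[k] (⨁ g, N g) ≃ₗ[k] Smash γ :=
  TensorProduct.directSumRight k k C N ≪≫ₗ DFinsupp.mapRange.linearEquiv e ≪≫ₗ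
    (finsuppLEquivDirectSum k C G).symm

theorem coef_tensorDirectSumEquivSmash (e : ∀ g, C ⊗[k] N g ≃ₗ[k] C) (g : G)
    (t : C ⊗[k] (⨁ g, N g)) :
    Smash.coef γ g (tensorDirectSumEquivSmash γ e t) =
      e g ((DirectSum.component k G N g).lTensor C t) := by
  classical
  suffices h : Smash.coef γ g ∘ₗ (tensorDirectSumEquivSmash γ e).toLinearMap =
      (e g).toLinearMap ∘ₗ (DirectSum.component k G N g).lTensor C from LinearMap.congr_fun h t
  refine TensorProduct.ext' fun c x => ?_
  exact congrArg (e g) (TensorProduct.directSumRight_tmul k k c x g)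

variable {e : ∀ g, C ⊗[k] N g ≃ₗ[k] C}

theorem tensorDirectSumEquivSmash_mem_moduleHom
    (he : ∀ g r t, e g ((selfAct k C r).rTensor (N g) t) = twistAct γ g r (e g t)) :
    (tensorDirectSumEquivSmash γ e).toLinearMap ∈
      moduleHom (tensorAct (selfAct k C) (⨁ g, N g)) (envAct (Smash.incl γ)) := by
  refine fun r t => Smash.ext_coef fun g => ?_
  simp only [LinearEquiv.coe_coe]
  rw [Smash.coef_mem_moduleHom, coef_tensorDirectSumEquivSmash, coef_tensorDirectSumEquivSmash,
    lTensor_mem_moduleHom]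
  exact he g r _

/-- The isomorphism `⨁ N_g ≅ Hom_{Cᵉ}(C, C # kG)` obtained from isomorphisms `C ⊗ N_g ≅ C # g`. -/
def directSumEquivSmashHom (hC : Function.Bijective (unitMap k C (⨁ g, N g)))
    (he : ∀ g r t, e g ((selfAct k C r).rTensor (N g) t) = twistAct γ g r (e g t)) :
    (⨁ g, N g) ≃ₗ[k] SmashHom γ :=
  homEquivOfTensorEquiv hC (tensorDirectSumEquivSmash γ e)
    (tensorDirectSumEquivSmash_mem_moduleHom he)

variable (hC : Function.Bijective (unitMap k C (⨁ g, N g)))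
  (he : ∀ g r t, e g ((selfAct k C r).rTensor (N g) t) = twistAct γ g r (e g t))

theorem coef_directSumEquivSmashHom (x : ⨁ g, N g) (g : G) (c : C) :
    Smash.coef γ g ((directSumEquivSmashHom hC he x).1 c) = e g (c ⊗ₜ x g) :=
  coef_tensorDirectSumEquivSmash e g (c ⊗ₜ x)

open scoped Classical in
theorem directSumEquivSmashHom_lof (g : G) (n : N g) (c : C) :
    (directSumEquivSmashHom hC he (DirectSum.lof k G N g n)).1 c = Smash.of γ g (e g (c ⊗ₜ n)) := by
  refine Smash.ext_coef fun h => ?_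
  rw [coef_directSumEquivSmashHom]
  obtain rfl | hgh := eq_or_ne g h
  · rw [Smash.coef_of, DirectSum.lof_apply]
  · rw [Smash.coef_of_ne _ hgh, DirectSum.lof_eq_of, DirectSum.of_eq_of_ne _ _ _ hgh.symm,
      TensorProduct.tmul_zero, map_zero]

variable [IsUnitalAlgebra k C]

theorem mem_smashHomGrading_part {g : G} {φ : SmashHom γ} :
    φ ∈ (smashHomGrading γ).part g ↔ ∀ c, Smash.of γ g (Smash.coef γ g (φ.1 c)) = φ.1 c :=
  forall_congr' fun _ => Smash.mem_range_of

open scoped Classical in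
theorem smashHomGrading_part_eq_range (g : G) :
    (smashHomGrading γ).part g =
      LinearMap.range ((directSumEquivSmashHom hC he).toLinearMap ∘ₗ DirectSum.lof k G N g) := by
  refine le_antisymm (fun φ hφ => ?_) ?_
  · obtain ⟨x, rfl⟩ := (directSumEquivSmashHom hC he).surjective φ
    refine ⟨x g, Subtype.ext (LinearMap.ext fun c => ?_)⟩
    rw [LinearMap.comp_apply, LinearEquiv.coe_coe, directSumEquivSmashHom_lof,
      ← mem_smashHomGrading_part.1 hφ c, coef_directSumEquivSmashHom]
  · rintro _ ⟨n, rfl⟩ c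
    exact ⟨_, (directSumEquivSmashHom_lof hC he g n c).symm⟩

theorem smashHomGrading_isGraded_of_tensorEquiv
    (hC : Function.Bijective (unitMap k C (⨁ g, N g)))
    (he : ∀ g r t, e g ((selfAct k C r).rTensor (N g) t) = twistAct γ g r (e g t)) :
    (smashHomGrading γ).IsGraded := by
  unfold Grading.IsGraded
  rw [funext (smashHomGrading_part_eq_range hC he)]
  exact isInternal_range_comp_lof _

end SmashHom

section Eval

variable {k G A : Type u} [CommRing k] [Group G]
  [NonUnitalRing A] [Module k A] [IsScalarTower k A A] [SMulCommClass k A A]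

/-- The identification of the part of degree `g` of `Hom_{Aᵉ}(A, A # kG)` with
`Hom_{Aᵉ}(A, A # g)`. -/
def partEquiv [IsUnitalAlgebra k A] (α : AlgAction k G A) (g : G) :
    (smashHomGrading α).part g ≃ₗ[k] moduleHom (selfAct k A) (twistAct α g) where
  toFun φ := ⟨Smash.coef α g ∘ₗ φ.1.1, comp_mem_moduleHom (Smash.coef_mem_moduleHom α g) φ.1.2⟩
  invFun f := ⟨⟨Smash.of α g ∘ₗ f.1, comp_mem_moduleHom (Smash.of_mem_moduleHom α g) f.2⟩,
    fun a => ⟨f.1 a, rfl⟩⟩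
  map_add' _ _ := Subtype.ext (LinearMap.comp_add _ _ _)
  map_smul' _ _ := Subtype.ext (LinearMap.comp_smul _ _ _)
  left_inv φ := Subtype.ext (Subtype.ext (LinearMap.ext (mem_smashHomGrading_part.1 φ.2)))
  right_inv f := Subtype.ext (LinearMap.ext fun a => Smash.coef_of α g (f.1 a))

theorem SmashHom.coef_mul [IsUnitalAlgebra k A] {α : AlgAction k G A} {g h : G}
    {φ ψ : SmashHom α} (hφ : φ ∈ (smashHomGrading α).part g) (hψ : ψ ∈ (smashHomGrading α).part h)
    (a b : A) : Smash.coef α (g * h) ((φ * ψ).1 (a * b)) =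
      Smash.coef α g (φ.1 a) * α.rho g (Smash.coef α h (ψ.1 b)) := by
  rw [EnvHom.mul_apply, ← mem_smashHomGrading_part.1 hφ a, ← mem_smashHomGrading_part.1 hψ b,
    Smash.of_mul_of, Smash.coef_of, Smash.coef_of, Smash.coef_of]

variable [IsTaylorAzumaya k A]

/-- The isomorphism `A ⊗ Hom_{Aᵉ}(A, A # g) ≅ A # g` given by evaluation. -/
def evalEquiv (α : AlgAction k G A) (g : G) : A ⊗[k] (smashHomGrading α).part g ≃ₗ[k] A :=
  (partEquiv α g).lTensor A ≪≫ₗ LinearEquiv.ofBijective _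
    (IsTaylorAzumaya.counit_bijective A (twistAct α g) (isUnitalModule_twistAct α g))

theorem evalEquiv_tmul (α : AlgAction k G A) (g : G) (a : A) (φ : (smashHomGrading α).part g) :
    evalEquiv α g (a ⊗ₜ φ) = Smash.coef α g (φ.1.1 a) := rfl

theorem evalEquiv_rTensor (α : AlgAction k G A) (g : G) (r : A ⊗[k] Aᵐᵒᵖ)
    (t : A ⊗[k] (smashHomGrading α).part g) :
    evalEquiv α g ((selfAct k A r).rTensor _ t) = twistAct α g r (evalEquiv α g t) :=
  comp_mem_moduleHom (counitMap_mem_moduleHom (twistAct α g))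
    (lTensor_mem_moduleHom (selfAct k A) (partEquiv α g).toLinearMap) r t

end Eval

section EvalTensor

variable {k G A B : Type u} [CommRing k] [Group G]
  [NonUnitalRing A] [Module k A] [NonUnitalRing B] [Module k B]

@[elab_as_elim]
theorem env_tmul_induction {p : (A ⊗[k] B) ⊗[k] (A ⊗[k] B)ᵐᵒᵖ → Prop}
    (r : (A ⊗[k] B) ⊗[k] (A ⊗[k] B)ᵐᵒᵖ) (zero : p 0) (add : ∀ r s, p r → p s → p (r + s))
    (tmul : ∀ a b a' b', p ((a ⊗ₜ b) ⊗ₜ op (a' ⊗ₜ b'))) : p r := by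
  induction r with
  | zero => exact zero
  | add r s hr hs => exact add r s hr hs
  | tmul x x' =>
    induction x' using MulOpposite.rec' with | _ x'
    induction x with
    | zero => rwa [TensorProduct.zero_tmul]
    | add x y hx hy => rw [TensorProduct.add_tmul]; exact add _ _ hx hy
    | tmul a b =>
      induction x' with
      | zero => rwa [MulOpposite.op_zero, TensorProduct.tmul_zero]
      | add x y hx hy => rw [MulOpposite.op_add, TensorProduct.tmul_add]; exact add _ _ hx hy
      | tmul a' b' => exact tmul a b a' b'

variable [IsScalarTower k A A] [SMulCommClass k A A] [IsScalarTower k B B] [SMulCommClass k B B]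

theorem twistAct_tmul_tmul (α : AlgAction k G A) (β : AlgAction k G B) (g : G)
    (a a' : A) (b b' : B) :
    twistAct (α.tensor β) g ((a ⊗ₜ b) ⊗ₜ op (a' ⊗ₜ b')) =
      TensorProduct.map (twistAct α g (a ⊗ₜ op a')) (twistAct β g (b ⊗ₜ op b')) :=
  TensorProduct.ext' fun x y => by
    have rho_tmul : (α.tensor β).rho g (a' ⊗ₜ b') = α.rho g a' ⊗ₜ β.rho g b' := rfl
    rw [TensorProduct.map_tmul, twistAct_tmul, twistAct_tmul, twistAct_tmul, rho_tmul,
      Algebra.TensorProduct.tmul_mul_tmul, Algebra.TensorProduct.tmul_mul_tmul]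

variable [IsTaylorAzumaya k A] [IsTaylorAzumaya k B]

/-- The isomorphism `(A ⊗ B) ⊗ (Hom_{Aᵉ}(A, A # g) ⊗ Hom_{Bᵉ}(B, B # g)) ≅ (A ⊗ B) # g` given by
evaluation in each factor. -/
def evalTensorEquiv (α : AlgAction k G A) (β : AlgAction k G B) (g : G) :
    (A ⊗[k] B) ⊗[k] ((smashHomGrading α).part g ⊗[k] (smashHomGrading β).part g)
      ≃ₗ[k] A ⊗[k] B :=
  TensorProduct.tensorTensorTensorComm k A B _ _ ≪≫ₗ
    TensorProduct.congr (evalEquiv α g) (evalEquiv β g)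

theorem evalTensorEquiv_rTensor (α : AlgAction k G A) (β : AlgAction k G B) (g : G)
    (r : (A ⊗[k] B) ⊗[k] (A ⊗[k] B)ᵐᵒᵖ)
    (t : (A ⊗[k] B) ⊗[k] ((smashHomGrading α).part g ⊗[k] (smashHomGrading β).part g)) :
    evalTensorEquiv α β g ((selfAct k (A ⊗[k] B) r).rTensor _ t) =
      twistAct (α.tensor β) g r (evalTensorEquiv α β g t) := by
  induction r using env_tmul_induction with
  | zero => simp only [map_zero, LinearMap.rTensor_zero, LinearMap.zero_apply]
  | add r s hr hs => simp only [map_add, LinearMap.rTensor_add, LinearMap.add_apply, hr, hs]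
  | tmul a b a' b' =>
    rw [selfAct_tmul_tmul, twistAct_tmul_tmul]
    suffices h : (evalTensorEquiv α β g).toLinearMap ∘ₗ (TensorProduct.map
        (selfAct k A (a ⊗ₜ op a')) (selfAct k B (b ⊗ₜ op b'))).rTensor _ =
          TensorProduct.map (twistAct α g (a ⊗ₜ op a')) (twistAct β g (b ⊗ₜ op b')) ∘ₗ
            (evalTensorEquiv α β g).toLinearMap from LinearMap.congr_fun h t
    exact TensorProduct.ext_fourfold' fun c d φ ψ => congrArg₂ (· ⊗ₜ ·)
      (evalEquiv_rTensor α g (a ⊗ₜ op a') (c ⊗ₜ φ)) (evalEquiv_rTensor β g (b ⊗ₜ op b') (d ⊗ₜ ψ))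

end EvalTensor

section Cotensor

variable {k G S T R : Type u} [CommRing k] [Group G] [Ring S] [Algebra k S] [Ring T] [Algebra k T]
  [NonUnitalNonAssocSemiring R] {𝒮 : Grading k G S} {𝒯 : Grading k G T}

theorem Cotensor.map_mul_of_tmul {Θ : Cotensor 𝒮 𝒯 →+ R}
    (hΘ : ∀ g h s hs t ht s' hs' t' ht',
      Θ (tmul 𝒮 𝒯 g s hs t ht * tmul 𝒮 𝒯 h s' hs' t' ht') =
        Θ (tmul 𝒮 𝒯 g s hs t ht) * Θ (tmul 𝒮 𝒯 h s' hs' t' ht'))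
    (x y : Cotensor 𝒮 𝒯) : Θ (x * y) = Θ x * Θ y := by
  induction x using Cotensor.induction with
  | zero => simp only [zero_mul, map_zero]
  | add x x' hx hx' => simp only [add_mul, map_add, hx, hx']
  | tmul g s hs t ht =>
    induction y using Cotensor.induction with
    | zero => simp only [mul_zero, map_zero]
    | add y y' hy hy' => simp only [mul_add, map_add, hy, hy']
    | tmul h s' hs' t' ht' => exact hΘ g h s hs t ht s' hs' t' ht'

end Cotensor

section Main

variable {k G A B : Type u} [CommRing k] [Group G]
  [NonUnitalRing A] [Module k A] [IsScalarTower k A A] [SMulCommClass k A A]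
  [NonUnitalRing B] [Module k B] [IsScalarTower k B B] [SMulCommClass k B B]
  [IsTaylorAzumaya k A] [IsTaylorAzumaya k B]

theorem smashHomGrading_isGraded (α : AlgAction k G A) : (smashHomGrading α).IsGraded :=
  smashHomGrading_isGraded_of_tensorEquiv (IsTaylorAzumaya.unit_bijective _) (evalEquiv_rTensor α)

theorem unitMap_tensor_bijective_of_isTaylorAzumaya (N : Type u) [AddCommGroup N] [Module k N] :
    Function.Bijective (unitMap k (A ⊗[k] B) N) :=
  unitMap_tensor_bijective (IsTaylorAzumaya.unit_bijective _) (IsTaylorAzumaya.unit_bijective _)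

theorem smashHomGrading_tensor_isGraded (α : AlgAction k G A) (β : AlgAction k G B) :
    (smashHomGrading (α.tensor β)).IsGraded :=
  smashHomGrading_isGraded_of_tensorEquiv (unitMap_tensor_bijective_of_isTaylorAzumaya _)
    (evalTensorEquiv_rTensor α β)

/-- The isomorphism of `k`-modules
`Hom_{Aᵉ}(A, A # kG) □ Hom_{Bᵉ}(B, B # kG) ≅ Hom_{(A ⊗ B)ᵉ}(A ⊗ B, (A ⊗ B) # kG)`. -/
def cotensorEquivSmashHom (α : AlgAction k G A) (β : AlgAction k G B) :
    Cotensor (smashHomGrading α) (smashHomGrading β) ≃ₗ[k] SmashHom (α.tensor β) :=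
  directSumEquivSmashHom (unitMap_tensor_bijective_of_isTaylorAzumaya _)
    (evalTensorEquiv_rTensor α β)

theorem cotensorEquivSmashHom_tmul (α : AlgAction k G A) (β : AlgAction k G B) {g : G}
    {φ : SmashHom α} (hφ : φ ∈ (smashHomGrading α).part g)
    {ψ : SmashHom β} (hψ : ψ ∈ (smashHomGrading β).part g) (a : A) (b : B) :
    (cotensorEquivSmashHom α β (Cotensor.tmul _ _ g φ hφ ψ hψ)).1 (a ⊗ₜ b) =
      Smash.of (α.tensor β) g (Smash.coef α g (φ.1 a) ⊗ₜ Smash.coef β g (ψ.1 b)) :=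
  (directSumEquivSmashHom_lof _ _ g _ _).trans <| congrArg (Smash.of _ g) <|
    congrArg₂ (· ⊗ₜ ·) (evalEquiv_tmul α g a ⟨φ, hφ⟩) (evalEquiv_tmul β g b ⟨ψ, hψ⟩)

theorem cotensorEquivSmashHom_one (α : AlgAction k G A) (β : AlgAction k G B) :
    cotensorEquivSmashHom α β 1 = 1 := by
  refine Subtype.ext (TensorProduct.ext' fun a b => ?_)
  rw [Cotensor.one_def, cotensorEquivSmashHom_tmul]
  exact congrArg₂ (fun x y => Smash.of _ 1 (x ⊗ₜ y)) (Smash.coef_of α 1 a) (Smash.coef_of β 1 b)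

theorem cotensorEquivSmashHom_tmul_mul_tmul (α : AlgAction k G A) (β : AlgAction k G B) {g h : G}
    {φ φ' : SmashHom α} (hφ : φ ∈ (smashHomGrading α).part g)
    (hφ' : φ' ∈ (smashHomGrading α).part h) {ψ ψ' : SmashHom β}
    (hψ : ψ ∈ (smashHomGrading β).part g) (hψ' : ψ' ∈ (smashHomGrading β).part h) :
    cotensorEquivSmashHom α β
        (Cotensor.tmul _ _ g φ hφ ψ hψ * Cotensor.tmul _ _ h φ' hφ' ψ' hψ') =
      cotensorEquivSmashHom α β (Cotensor.tmul _ _ g φ hφ ψ hψ) *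
        cotensorEquivSmashHom α β (Cotensor.tmul _ _ h φ' hφ' ψ' hψ') := by
  refine EnvHom.ext_mul fun u v => ?_
  rw [EnvHom.mul_apply]
  induction u with
  | zero => simp only [zero_mul, map_zero]
  | add u u' hu hu' => simp only [add_mul, map_add, hu, hu']
  | tmul a b =>
    induction v with
    | zero => simp only [mul_zero, map_zero]
    | add v v' hv hv' => simp only [mul_add, map_add, hv, hv']
    | tmul a' b' =>
      rw [Cotensor.tmul_mul_tmul, Algebra.TensorProduct.tmul_mul_tmul, cotensorEquivSmashHom_tmul,
        cotensorEquivSmashHom_tmul, cotensorEquivSmashHom_tmul, Smash.of_mul_of,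
        SmashHom.coef_mul hφ hφ', SmashHom.coef_mul hψ hψ']
      exact congrArg _ (Algebra.TensorProduct.tmul_mul_tmul _ _ _ _).symm

theorem cotensorEquivSmashHom_mul (α : AlgAction k G A) (β : AlgAction k G B)
    (x y : Cotensor (smashHomGrading α) (smashHomGrading β)) :
    cotensorEquivSmashHom α β (x * y) =
      cotensorEquivSmashHom α β x * cotensorEquivSmashHom α β y :=
  Cotensor.map_mul_of_tmul (R := SmashHom (α.tensor β))
    (Θ := (cotensorEquivSmashHom α β).toAddEquiv.toAddMonoidHom)
    (fun _ _ _ hφ _ hψ _ hφ' _ hψ' => cotensorEquivSmashHom_tmul_mul_tmul α β hφ hφ' hψ hψ') x y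

theorem mem_cotensorGrading_part_iff (α : AlgAction k G A) (β : AlgAction k G B) (g : G)
    (x : Cotensor (smashHomGrading α) (smashHomGrading β)) :
    x ∈ (Cotensor.grading (smashHomGrading α) (smashHomGrading β)).part g ↔
      cotensorEquivSmashHom α β x ∈ (smashHomGrading (α.tensor β)).part g := by
  rw [smashHomGrading_part_eq_range (unitMap_tensor_bijective_of_isTaylorAzumaya _)
    (evalTensorEquiv_rTensor α β) g]
  exact exists_congr fun n => (cotensorEquivSmashHom α β).injective.eq_iff.symm

/-- The isomorphism of graded algebras
`Hom_{Aᵉ}(A, A # kG) □ Hom_{Bᵉ}(B, B # kG) ≅ Hom_{(A ⊗ B)ᵉ}(A ⊗ B, (A ⊗ B) # kG)`. -/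
def cotensorGradedAlgEquiv (α : AlgAction k G A) (β : AlgAction k G B) :
    GradedAlgEquiv (Cotensor.grading (smashHomGrading α) (smashHomGrading β))
      (smashHomGrading (α.tensor β)) where
  toAlgEquiv := AlgEquiv.ofLinearEquiv (cotensorEquivSmashHom α β)
    (cotensorEquivSmashHom_one α β) (cotensorEquivSmashHom_mul α β)
  map_part := mem_cotensorGrading_part_iff α β

end Main

end TaylorAzumaya

end

theorem lemma3p7 {k G A B : Type u} [CommRing k] [Group G]
    [NonUnitalRing A] [Module k A] [IsScalarTower k A A] [SMulCommClass k A A]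
    [NonUnitalRing B] [Module k B] [IsScalarTower k B B] [SMulCommClass k B B]
    [TaylorAzumaya.IsTaylorAzumaya k A] [TaylorAzumaya.IsTaylorAzumaya k B]
    (α : TaylorAzumaya.AlgAction k G A) (β : TaylorAzumaya.AlgAction k G B) :
    (TaylorAzumaya.smashHomGrading α).IsGraded ∧
    (TaylorAzumaya.smashHomGrading β).IsGraded ∧
    (TaylorAzumaya.smashHomGrading (α.tensor β)).IsGraded ∧
    Nonempty (TaylorAzumaya.GradedAlgEquiv
      (TaylorAzumaya.Cotensor.grading
        (TaylorAzumaya.smashHomGrading α) (TaylorAzumaya.smashHomGrading β))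
      (TaylorAzumaya.smashHomGrading (α.tensor β))) := by
  exact ⟨TaylorAzumaya.smashHomGrading_isGraded α, TaylorAzumaya.smashHomGrading_isGraded β,
    TaylorAzumaya.smashHomGrading_tensor_isGraded α β,
    ⟨TaylorAzumaya.cotensorGradedAlgEquiv α β⟩⟩
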